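/- **Setting.** Let $0<\rho\le v_{\max}$ and $T\ge 1$ rounds. In round $t$ a buyer with total budget $B=\rho T$ has value $v_t\in[0,v_{\max}]$ in a second-price auction whose highest competing bid is $p_t\in[0,v_{\max}]$; she chooses $x_t\in\{0,1\}$ after seeing $v_t$, and receives revenue $x_tr_t$ and pays $x_tc_t$, where $r_t=(v_t-p_t)^+$ and $c_t=p_t\mathbf 1[v_t\ge p_t]$. With partial feedback, $p_t$ is seen at the end of round $t$ only if $x_t=1$. **Algorithm OGD-CB (partial feedback).** Put $\mathcal I_1=\emptyset$, $B_1=B$, $\lambda_1=0$. For $t=1,\dots,T$: if $t=1$, set $x_1=1$ and $\lambda_2=\lambda_1$. If $t\ge2$, set $\epsilon_t=\sqrt{(\ln 2+2\ln T)/(2|\mathcal I_t|)}$, $$\tilde r_t=\frac1{|\mathcal I_t|}\sum_{\tau\in\mathcal I_t}(v_t-p_\tau)^+ +\epsilon_tv_t,\qquad \tilde c_t=\frac1{|\mathcal I_t|}\sum_{\tau\in\mathcal I_t}p_\tau\mathbf 1[v_t\ge p_\tau]-2\epsilon_tv_t,$$ $x_t=\mathbf 1[\tilde r_t\ge\lambda_t\tilde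 c_t]$, $\eta_t=1/(v_{\max}\sqrt t)$ and $\lambda_{t+1}=(\lambda_t+\eta_t(x_t\tilde c_t-\rho))^+$. In every round, if $x_t=1$ then $p_t$ is observed and $\mathcal I_{t+1}=\mathcal I_t\cup\{t\}$; otherwise $\mathcal I_{t+1}=\mathcal I_t$. Finally $B_{t+1}=B_t-x_tc_t$, and the algorithm stops after round $t$ if $B_{t+1}<v_{\max}$ (then $x_s=0$ for all $s>t$). With $T_0$ the last round in which $x_t=1$, its total revenue is $\sum_{t=1}^{T_0}x_tr_t$. **Benchmark.** For probability distributions $F,G$ on $[0,v_{\max}]$ let $$\mathrm{OPT}=T\cdot\sup_{\pi}\ \mathbb E_{v\sim F,\,p\sim G}\big[\pi(v)(v-p)^+\big]\quad\text{s.t.}\quad\mathbb E_{v\sim F,\,p\sim G}\big[\pi(v)\,p\,\mathbf 1[v\ge p]\big]\le\rho ,$$ over measurable $\pi:[0,v_{\max}]\to[0,1]$ (with $v$ and $p$ independent), and let $\mathrm{Reg}=\mathrm{OPT}-\sum_{t=1}^{T_0}x_tr_t$. **Theorem.** Fix $0<\rho\le v_{\max}$. 1. (Entering frequency.) Let $C_e=\min\{\tfrac12(\rho/v_{\max})^2,\tfrac{\sqrt2}{4}(\rho/v_{\max})\}$.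 For every $T$, every $(v_t)_{t\le T},(p_t)_{t\le T}\in[0,v_{\max}]^T$ and every $2\le t\le T+1$ such that round $t-1$ was executed (the algorithm did not stop before it), $|\mathcal I_t|\ge C_e\,(t-1)$. 2. (High probability.) There is a constant $C$ depending only on $v_{\max}$ and $\rho$ such that for all $T\ge1$ and all distributions $F,G$ on $[0,v_{\max}]$, if $v_1,\dots,v_T$ are i.i.d. from $F$, $p_1,\dots,p_T$ are i.i.d. from $G$, and the two sequences are independent, then with probability at least $1-4/T$, $\ \mathrm{Reg}\le C\sqrt{T\ln T}$. 3. (Expectation.) There is a constant $C'$ depending only on $v_{\max}$ and $\rho$ such that, in the same setting and for all $T\ge2$, $\mathrm{Reg}$ is integrable and $\mathbb E[\mathrm{Reg}]\le C'\sqrt{T\ln T}$. -/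

import Mathlib

open MeasureTheory

namespace OGDCB

/-! ### The repeated second-price auction -/

/-- Revenue `(v - p)^+` of an entered auction with value `v` and highest competing bid `p`. -/
noncomputable def rev (v p : ℝ) : ℝ := max (v - p) 0

open Classical in
/-- Cost `p 𝟏[v ≥ p]` of an entered auction with value `v` and highest competing bid `p`. -/
noncomputable def cost (v p : ℝ) : ℝ := if v ≥ p then p else 0

/-- Expected revenues per round of the feasible static randomised throttling policies `π`:
a buyer with value `v` enters with probability `π v`, and the expected cost is at most `ρ`. -/
def fluidValues (ρ : ℝ) (F G : Measure ℝ) : Set ℝ :=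
  {R | ∃ π : ℝ → ℝ, Measurable π ∧ (∀ v, π v ∈ Set.Icc (0 : ℝ) 1) ∧
    ∫ z, π z.1 * cost z.1 z.2 ∂(F.prod G) ≤ ρ ∧
    R = ∫ z, π z.1 * rev z.1 z.2 ∂(F.prod G)}

/-- The fluid adaptive throttling benchmark. -/
noncomputable def OPT (ρ : ℝ) (T : ℕ) (F G : Measure ℝ) : ℝ := T * sSup (fluidValues ρ F G)

/-- `[T] = {1, …, T}`-indexing of a vector with `T` entries: `entry x t` is the `t`-th entry
for `1 ≤ t ≤ T`; the value elsewhere is never used. -/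
def entry {T : ℕ} (x : Fin T → ℝ) (t : ℕ) : ℝ :=
  if h : 1 ≤ t ∧ t ≤ T then x ⟨t - 1, by omega⟩ else 0

/-! ### The algorithm OGD-CB with partial information feedback -/

/-- What the algorithm carries at the start of round `t`: the set of rounds whose competing bid
has been observed, the pricing parameter `λ_t`, the remaining budget `B_t`, and whether the loop
is still running (no `break` so far). -/
structure State where
  observed : Finset ℕ
  lam : ℝ
  budget : ℝ
  running : Prop

/-- Confidence radius `ε_t = √((ln 2 + 2 ln T) / (2 |I_t|))`. -/
noncomputable def radius (T : ℕ) (I : Finset ℕ) : ℝ :=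
  Real.sqrt ((Real.log 2 + 2 * Real.log T) / (2 * (I.card : ℝ)))

/-- The (optimistic) revenue estimate; it reads `p` only on the set `I` of observed rounds. -/
noncomputable def estRev (T : ℕ) (p : ℕ → ℝ) (I : Finset ℕ) (v : ℝ) : ℝ :=
  (∑ τ ∈ I, rev v (p τ)) / (I.card : ℝ) + radius T I * v

/-- The (optimistic) cost estimate; it reads `p` only on the set `I` of observed rounds. -/
noncomputable def estCost (T : ℕ) (p : ℕ → ℝ) (I : Finset ℕ) (v : ℝ) : ℝ :=
  (∑ τ ∈ I, cost v (p τ)) / (I.card : ℝ) - 2 * radius T I * v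

/-- The decision `x_t = 1` in round `t` from state `s` with value `v`. Round `1` is exploration;
no round is entered once the loop has been left. -/
def Enters (T : ℕ) (p : ℕ → ℝ) (t : ℕ) (s : State) (v : ℝ) : Prop :=
  s.running ∧ (t = 1 ∨ estRev T p s.observed v ≥ s.lam * estCost T p s.observed v)

/-- Step size `η_t = 1 / (v_max √t)`. -/
noncomputable def stepSize (vmax : ℝ) (t : ℕ) : ℝ := 1 / (vmax * Real.sqrt t)

open Classical in
/-- Execution of round `t`, with value `v t` and competing bid `p t`. The bid is observed exactly
when the round is entered. After a `break` nothing changes any more. -/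
noncomputable def step (vmax ρ : ℝ) (T : ℕ) (v p : ℕ → ℝ) (t : ℕ) (s : State) : State :=
  let x : ℝ := if Enters T p t s (v t) then 1 else 0
  let newBudget : ℝ := s.budget - x * cost (v t) (p t)
  if s.running then
    { observed := if Enters T p t s (v t) then insert t s.observed else s.observed
      lam := if t = 1 then s.lam
        else max (s.lam + stepSize vmax t * (x * estCost T p s.observed (v t) - ρ)) 0
      budget := newBudget
      running := ¬ newBudget < vmax }
  else s

/-- Initialization, with total budget `B = ρ T`. -/
noncomputable def init (ρ : ℝ) (T : ℕ) : State where
  observed := ∅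
  lam := 0
  budget := ρ * T
  running := True

/-- `stateAt vmax ρ T v p t` is the state at the start of round `t ≥ 1` (rounds are numbered from
`1`; the value at `0` is a dummy). -/
noncomputable def stateAt (vmax ρ : ℝ) (T : ℕ) (v p : ℕ → ℝ) : ℕ → State
  | 0 => init ρ T
  | 1 => init ρ T
  | t + 2 => step vmax ρ T v p (t + 1) (stateAt vmax ρ T v p (t + 1))

/-- The algorithm enters round `t`, i.e. `x_t = 1`. -/
def Entered (vmax ρ : ℝ) (T : ℕ) (v p : ℕ → ℝ) (t : ℕ) : Prop :=
  Enters T p t (stateAt vmax ρ T v p t) (v t)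

open Classical in
/-- The ending time `T_0`: the last round `t ≤ T` with `x_t = 1`. -/
noncomputable def endTime (vmax ρ : ℝ) (T : ℕ) (v p : ℕ → ℝ) : ℕ :=
  ((Finset.Icc 1 T).filter fun t => Entered vmax ρ T v p t).sup id

open Classical in
/-- Total revenue `∑_{t ≤ T_0} x_t r_t` of the algorithm on the inputs `v, p`. -/
noncomputable def revenue (vmax ρ : ℝ) {T : ℕ} (v p : Fin T → ℝ) : ℝ :=
  ∑ t ∈ Finset.Icc 1 (endTime vmax ρ T (entry v) (entry p)),
    (if Entered vmax ρ T (entry v) (entry p) t then 1 else 0) * rev (entry v t) (entry p t)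

/-- Regret of the algorithm against the fluid benchmark on the inputs `z = (v, p)`. -/
noncomputable def regret (vmax ρ : ℝ) {T : ℕ} (F G : Measure ℝ)
    (z : (Fin T → ℝ) × (Fin T → ℝ)) : ℝ :=
  OPT ρ T F G - revenue vmax ρ z.1 z.2

/-- Law `F^T × G^T` of the pair `(v, p)`: all values are i.i.d. from `F`, all competing bids are
i.i.d. from `G`, and values and bids are independent. -/
noncomputable def inputLaw (T : ℕ) (F G : Measure ℝ) : Measure ((Fin T → ℝ) × (Fin T → ℝ)) :=
  (Measure.pi fun _ : Fin T => F).prod (Measure.pi fun _ : Fin T => G)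

/-- The entering-frequency constant `min {(1/2)(ρ/v_max)², (√2/4)(ρ/v_max)}`. -/
noncomputable def freqConst (vmax ρ : ℝ) : ℝ :=
  min ((1 / 2 : ℝ) * (ρ / vmax) ^ 2) (Real.sqrt 2 / 4 * (ρ / vmax))

end OGDCB

namespace OGDCB

/-! ### Partial sums of inverse square roots -/

/-! The argument separates what holds on every input from what holds with high probability.

Entering frequency. Put `a = ρ / vmax`. Estimated costs never exceed `vmax`, so in round `t` the
price `λ` rises by at most `(1 - a)/√t` if the round is entered, and it is lowered by `a/√t`, up to
projection, if it is not. Let `s` be the last round up to `n` with `λ_s = 0`. After `s` the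
projection at `0` is inactive, so `λ_n ≥ 0` forces the entered rounds of the window to carry at
least the fraction `a` of its total weight `∑ 1/√i`. The weights decrease and their partial sums
divided by `√l` increase, so a window of length `l` contains at least `a² l` entered rounds
(`sq_mul_le_card_filter`). Strong induction handles the rounds before `s`
(`half_sq_mul_le_card_observed`).

Bounded price. `λ` can rise only if the round is entered with estimated cost above `ρ`. The term `-2
ε v` in that estimate then forces `ε < 1/2`, so the estimated revenue is at most `3 vmax / 2`, and
the entering test gives `λ ≤ 3 vmax / (2 ρ)` before a step of size at most `1` (`lam_le`).

Regret. Each decision maximizes the estimated Lagrangian, so it does at least as well as any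
feasible static policy, up to the estimation error and the dual term `λ_t · grad_t`. The regret
bound of gradient descent replaces `λ_t` in the dual term by a fixed comparator: `0` if the budget
lasts, and otherwise `vmax / ρ`, which pays `vmax` for each round lost after stopping. What remains
is a list of deviations, collected in `Favourable`; `Favourable.regret_le` is then deterministic.

Probability. By the entering frequency, round `t` has order `t` samples, so the estimates have error
`O(√(ln T / t))`, which sums to `O(√(T ln T))`. The sample set is adaptive, but the decision of a
round never depends on its own bid. Thus centred sums over entered rounds are martingales, even with
all values fixed in advance. Azuma–Hoeffding, proved by resampling one coordinate at a time
(`measureReal_sum_ge_le`), controls them, and a union bound over fewer than `4 T + 1` events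
finishes the proof. The expectation bound follows because the regret never exceeds `T vmax`. -/

/-- The partial sum `∑_{i < m} 1 / √(s + i)`. -/
noncomputable def invSqrtSum (s m : ℕ) : ℝ := ∑ i ∈ Finset.range m, 1 / Real.sqrt ((s + i : ℕ) : ℝ)

lemma invSqrtSum_succ (s m : ℕ) :
    invSqrtSum s (m + 1) = invSqrtSum s m + 1 / Real.sqrt ((s + m : ℕ) : ℝ) :=
  Finset.sum_range_succ _ _

/-- Multiplied by `√(m+1) - √m`, this is exactly the increment condition that makes the partial sum
divided by `√m` nondecreasing. The induction closes because `(s+m+1)/(s+m) ≤ (m+2)/(m+1)` for `s ≥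
1`, together with `√m √(m+2) ≤ m + 1`. -/
lemma invSqrtSum_mul_sqrt_le {s : ℕ} (hs : 1 ≤ s) (m : ℕ) :
    invSqrtSum s m * Real.sqrt ((s + m : ℕ) : ℝ) ≤
      Real.sqrt m * (Real.sqrt (m + 1) + Real.sqrt m) := by
  induction m with
  | zero => simp [invSqrtSum]
  | succ m ih =>
    have hsR : (1 : ℝ) ≤ s := by exact_mod_cast hs
    have hm0 : (0 : ℝ) ≤ m := Nat.cast_nonneg m
    rw [invSqrtSum_succ]
    push_cast at ih ⊢
    set A := Real.sqrt ((s : ℝ) + m) with hA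
    set B := Real.sqrt ((s : ℝ) + (m + 1)) with hB
    set u := Real.sqrt (m : ℝ)
    set w := Real.sqrt ((m : ℝ) + 1)
    set y := Real.sqrt ((m : ℝ) + 1 + 1)
    have hA0 : 0 < A := Real.sqrt_pos.2 (by linarith)
    have hw0 : 0 < w := Real.sqrt_pos.2 (by linarith)
    have hB0 : 0 < B := Real.sqrt_pos.2 (by linarith)
    have hu0 : 0 ≤ u := Real.sqrt_nonneg _
    have hy0 : 0 ≤ y := Real.sqrt_nonneg _
    have hA2 : A ^ 2 = s + m := Real.sq_sqrt (by linarith)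
    have hB2 : B ^ 2 = s + (m + 1) := Real.sq_sqrt (by linarith)
    have hu2 : u ^ 2 = m := Real.sq_sqrt (by linarith)
    have hw2 : w ^ 2 = m + 1 := Real.sq_sqrt (by linarith)
    have hy2 : y ^ 2 = m + 1 + 1 := Real.sq_sqrt (by linarith)
    have hBA : B * w ≤ y * A := by
      refine le_of_sq_le_sq ?_ (by positivity)
      rw [mul_pow, mul_pow, hA2, hB2, hw2, hy2]
      nlinarith
    have huy : u * y ≤ w ^ 2 := by
      refine le_of_sq_le_sq ?_ (by positivity)
      rw [mul_pow, hu2, hy2, hw2]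
      nlinarith
    have hkey : (invSqrtSum s m + 1 / A) * A ≤ w * (u + w) := by
      have : (invSqrtSum s m + 1 / A) * A = invSqrtSum s m * A + 1 := by field_simp
      nlinarith
    have h1 : (invSqrtSum s m + 1 / A) * B * (w * A) ≤ (w * (y + w)) * (w * A) := by
      have h2 : (invSqrtSum s m + 1 / A) * A * (B * w) ≤ (w * (u + w)) * (y * A) :=
        mul_le_mul hkey hBA (by positivity) (by positivity)
      have h3 : (w * (u + w)) * (y * A) ≤ (w * (y + w)) * (w * A) := by
        have h4 : (u * y) * (w * A) ≤ w ^ 2 * (w * A) :=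
          mul_le_mul_of_nonneg_right huy (by positivity)
        nlinarith
      nlinarith
    exact le_of_mul_le_mul_right h1 (by positivity)

lemma invSqrtSum_mul_sqrt_succ_le {s : ℕ} (hs : 1 ≤ s) (m : ℕ) :
    invSqrtSum s m * Real.sqrt ((m + 1 : ℕ) : ℝ) ≤ invSqrtSum s (m + 1) * Real.sqrt m := by
  have h := invSqrtSum_mul_sqrt_le hs m
  have hsR : (1 : ℝ) ≤ s := by exact_mod_cast hs
  have hm0 : (0 : ℝ) ≤ m := Nat.cast_nonneg m
  rw [invSqrtSum_succ]
  push_cast at h ⊢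
  set A := Real.sqrt ((s : ℝ) + m)
  set u := Real.sqrt (m : ℝ)
  set w := Real.sqrt ((m : ℝ) + 1)
  have hA0 : 0 < A := Real.sqrt_pos.2 (by linarith)
  have hw0 : 0 < w := Real.sqrt_pos.2 (by linarith)
  have hu0 : 0 ≤ u := Real.sqrt_nonneg _
  have hu2 : u ^ 2 = m := Real.sq_sqrt (by linarith)
  have hw2 : w ^ 2 = m + 1 := Real.sq_sqrt (by linarith)
  have huw : u ≤ w := Real.sqrt_le_sqrt (by linarith)
  have h1 : invSqrtSum s m * (w - u) * A ≤ u := by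
    have h2 := mul_le_mul_of_nonneg_right h (sub_nonneg.2 huw)
    have h3 : u * (w + u) * (w - u) = u := by
      have : (w + u) * (w - u) = 1 := by nlinarith
      rw [mul_assoc, this, mul_one]
    nlinarith
  have h4 : invSqrtSum s m * (w - u) ≤ u / A := by rwa [le_div_iff₀ hA0]
  have h5 : (invSqrtSum s m + 1 / A) * u = invSqrtSum s m * u + u / A := by ring
  rw [h5]
  linarith

lemma invSqrtSum_mul_sqrt_le_of_le {s : ℕ} (hs : 1 ≤ s) {k l : ℕ} (hkl : k ≤ l) :
    invSqrtSum s k * Real.sqrt l ≤ invSqrtSum s l * Real.sqrt k := by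
  induction l, hkl using Nat.le_induction with
  | base => exact le_rfl
  | succ l hkl ih =>
    rcases Nat.eq_zero_or_pos l with rfl | hl
    · obtain rfl : k = 0 := by omega
      simp [invSqrtSum]
    · have h := invSqrtSum_mul_sqrt_succ_le hs l
      have hl0 : 0 < Real.sqrt (l : ℝ) := Real.sqrt_pos.2 (by exact_mod_cast hl)
      refine le_of_mul_le_mul_right ?_ hl0
      calc invSqrtSum s k * Real.sqrt ((l + 1 : ℕ) : ℝ) * Real.sqrt l
          = invSqrtSum s k * Real.sqrt l * Real.sqrt ((l + 1 : ℕ) : ℝ) := by ring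
        _ ≤ invSqrtSum s l * Real.sqrt k * Real.sqrt ((l + 1 : ℕ) : ℝ) := by gcongr
        _ = invSqrtSum s l * Real.sqrt ((l + 1 : ℕ) : ℝ) * Real.sqrt k := by ring
        _ ≤ invSqrtSum s (l + 1) * Real.sqrt l * Real.sqrt k := by gcongr
        _ = _ := by ring

/-- The weights decrease, so among index sets of a given size the initial segment is the heaviest.
-/
lemma sum_filter_inv_sqrt_le {s : ℕ} (hs : 1 ≤ s) (P : ℕ → Prop) [DecidablePred P] (l : ℕ) :
    ∑ i ∈ (Finset.range l).filter P, 1 / Real.sqrt ((s + i : ℕ) : ℝ) ≤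
      invSqrtSum s ((Finset.range l).filter P).card := by
  induction l with
  | zero => simp [invSqrtSum]
  | succ l ih =>
    rw [Finset.range_add_one, Finset.filter_insert]
    split_ifs with hP
    · rw [Finset.sum_insert (by simp), Finset.card_insert_of_notMem (by simp), invSqrtSum_succ,
        add_comm]
      have hcard : ((Finset.range l).filter P).card ≤ l := by
        simpa using Finset.card_filter_le (Finset.range l) P
      refine add_le_add ih (one_div_le_one_div_of_le (Real.sqrt_pos.2 ?_) (Real.sqrt_le_sqrt ?_))
      · exact_mod_cast Nat.lt_of_lt_of_le hs (Nat.le_add_right _ _)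
      · exact_mod_cast Nat.add_le_add_left hcard s
    · exact ih

/-- If `S l` is the total weight and `k` indices are selected, then `a S l ≤ S k ≤ S l √(k/l)`.
Cancelling `S l` and squaring turns a fraction `a` of the weight into a fraction `a²` of the
indices. -/
lemma sq_mul_le_card_filter {s : ℕ} (hs : 1 ≤ s) (P : ℕ → Prop) [DecidablePred P] (l : ℕ)
    {a : ℝ} (ha : 0 ≤ a) (h : a * invSqrtSum s l ≤
      ∑ i ∈ (Finset.range l).filter P, 1 / Real.sqrt ((s + i : ℕ) : ℝ)) :
    a ^ 2 * l ≤ (((Finset.range l).filter P).card : ℝ) := by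
  set k := ((Finset.range l).filter P).card
  rcases Nat.eq_zero_or_pos l with hl | hl
  · rw [hl]; simp
  have hkl : k ≤ l := by simpa using Finset.card_filter_le (Finset.range l) P
  have h1 := h.trans (sum_filter_inv_sqrt_le hs P l)
  have h2 := invSqrtSum_mul_sqrt_le_of_le hs hkl
  have hpos : 0 < invSqrtSum s l := by
    refine Finset.sum_pos (fun i _ => ?_) ⟨0, by simpa using hl⟩
    have : (0 : ℝ) < ((s + i : ℕ) : ℝ) := by exact_mod_cast Nat.lt_of_lt_of_le hs (by omega)
    positivity
  have h3 : a * Real.sqrt l ≤ Real.sqrt k := by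
    refine le_of_mul_le_mul_left ?_ hpos
    have := mul_le_mul_of_nonneg_right h1 (Real.sqrt_nonneg (l : ℝ))
    nlinarith
  have h4 := pow_le_pow_left₀ (by positivity) h3 2
  rwa [mul_pow, Real.sq_sqrt (Nat.cast_nonneg _), Real.sq_sqrt (Nat.cast_nonneg _)] at h4

lemma sum_inv_sqrt_le (n : ℕ) : ∑ t ∈ Finset.Icc 1 n, 1 / Real.sqrt t ≤ 2 * Real.sqrt n := by
  induction n with
  | zero => simp
  | succ n ih =>
    rw [Finset.sum_Icc_succ_top (by omega)]
    have h1 : 0 < Real.sqrt ((n + 1 : ℕ) : ℝ) := Real.sqrt_pos.2 (by positivity)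
    have h2 : Real.sqrt n ^ 2 = n := Real.sq_sqrt (Nat.cast_nonneg _)
    have h3 : Real.sqrt ((n + 1 : ℕ) : ℝ) ^ 2 = (n + 1 : ℕ) := Real.sq_sqrt (Nat.cast_nonneg _)
    push_cast at h1 h3 ⊢
    have h4 : 1 / Real.sqrt ((n : ℝ) + 1) ≤ 2 * (Real.sqrt ((n : ℝ) + 1) - Real.sqrt n) := by
      rw [div_le_iff₀ h1]
      nlinarith [sq_nonneg (Real.sqrt ((n : ℝ) + 1) - Real.sqrt n)]
    linarith

lemma sum_inv_mul_sqrt_le (n : ℕ) :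
    ∑ t ∈ Finset.Icc 1 n, 1 / (t * Real.sqrt t) ≤ 3 := by
  -- The correction `-2/√(n+1)` makes the induction telescope; the bare bound by `3` is not
  -- inductive.
  have key : ∀ n : ℕ, ∑ t ∈ Finset.Icc 1 (n + 1), 1 / (t * Real.sqrt t) ≤
      3 - 2 / Real.sqrt ((n : ℝ) + 1) := by
    intro n
    induction n with
    | zero => norm_num
    | succ n ih =>
      rw [Finset.sum_Icc_succ_top (by omega)]
      push_cast
      set u := Real.sqrt ((n : ℝ) + 1)
      set w := Real.sqrt ((n : ℝ) + 1 + 1)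
      have hu : 0 < u := Real.sqrt_pos.2 (by positivity)
      have hw : 0 < w := Real.sqrt_pos.2 (by positivity)
      have hu2 : u ^ 2 = n + 1 := Real.sq_sqrt (by positivity)
      have hw2 : w ^ 2 = n + 1 + 1 := Real.sq_sqrt (by positivity)
      have huw : u ≤ w := Real.sqrt_le_sqrt (by linarith)
      have h : 1 / (((n : ℝ) + 1 + 1) * w) ≤ 2 / u - 2 / w := by
        rw [← hw2, div_sub_div _ _ hu.ne' hw.ne', div_le_div_iff₀ (by positivity) (by positivity)]
        have h1 : (w - u) * (w + u) = 1 := by nlinarith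
        have h2 : 1 ≤ (w - u) * (2 * w) := by nlinarith
        nlinarith [mul_le_mul_of_nonneg_right h2 (by positivity : 0 ≤ w ^ 2),
          mul_le_mul_of_nonneg_left huw hw.le]
      linarith
  rcases n with _ | n
  · simp
  · exact (key n).trans (by simp; positivity)

/-! ### Deterministic properties of the algorithm -/

open Classical in
/-- The decision `x_t ∈ {0, 1}` of the algorithm. -/
noncomputable def act (vmax ρ : ℝ) (T : ℕ) (v p : ℕ → ℝ) (t : ℕ) : ℝ :=
  if Entered vmax ρ T v p t then 1 else 0

open Classical in
/-- The indicator of the event that round `t` is executed. -/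
noncomputable def alive (vmax ρ : ℝ) (T : ℕ) (v p : ℕ → ℝ) (t : ℕ) : ℝ :=
  if (stateAt vmax ρ T v p t).running then 1 else 0

lemma rev_nonneg (v p : ℝ) : 0 ≤ rev v p := le_max_right _ _

lemma rev_le {v p : ℝ} (hv : 0 ≤ v) (hp : 0 ≤ p) : rev v p ≤ v :=
  max_le (by linarith) hv

lemma cost_nonneg {v p : ℝ} (hp : 0 ≤ p) : 0 ≤ cost v p := by
  unfold cost; split_ifs <;> simp [hp]

lemma cost_le {v p : ℝ} (hv : 0 ≤ v) : cost v p ≤ v := by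
  unfold cost; split_ifs with h
  · exact h
  · exact hv

lemma radius_nonneg (T : ℕ) (I : Finset ℕ) : 0 ≤ radius T I := Real.sqrt_nonneg _

section Deterministic

variable {vmax ρ : ℝ} {T : ℕ} {v p : ℕ → ℝ}

lemma act_nonneg (t : ℕ) : 0 ≤ act vmax ρ T v p t := by unfold act; split_ifs <;> simp

lemma act_le_one (t : ℕ) : act vmax ρ T v p t ≤ 1 := by unfold act; split_ifs <;> simp

lemma alive_nonneg (t : ℕ) : 0 ≤ alive vmax ρ T v p t := by unfold alive; split_ifs <;> simp

lemma alive_le_one (t : ℕ) : alive vmax ρ T v p t ≤ 1 := by unfold alive; split_ifs <;> simp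

lemma Entered.running {t : ℕ} (h : Entered vmax ρ T v p t) :
    (stateAt vmax ρ T v p t).running := h.1

lemma act_eq_zero_of_not_running {t : ℕ} (h : ¬ (stateAt vmax ρ T v p t).running) :
    act vmax ρ T v p t = 0 := if_neg fun h' => h h'.running

lemma stateAt_succ {t : ℕ} (ht : 1 ≤ t) :
    stateAt vmax ρ T v p (t + 1) = step vmax ρ T v p t (stateAt vmax ρ T v p t) := by
  obtain ⟨t, rfl⟩ := Nat.exists_eq_add_of_le' ht
  rfl

lemma stateAt_succ_of_not_running {t : ℕ} (ht : 1 ≤ t)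
    (h : ¬ (stateAt vmax ρ T v p t).running) :
    stateAt vmax ρ T v p (t + 1) = stateAt vmax ρ T v p t := by
  rw [stateAt_succ ht, step, if_neg h]

lemma running_of_succ {t : ℕ} (ht : 1 ≤ t) (h : (stateAt vmax ρ T v p (t + 1)).running) :
    (stateAt vmax ρ T v p t).running := by
  by_contra h'
  rw [stateAt_succ_of_not_running ht h'] at h
  exact h' h

lemma running_of_le {s t : ℕ} (hs : 1 ≤ s) (hst : s ≤ t)
    (h : (stateAt vmax ρ T v p t).running) : (stateAt vmax ρ T v p s).running := by
  induction t, hst using Nat.le_induction with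
  | base => exact h
  | succ t hst ih => exact ih (running_of_succ (hs.trans hst) h)

lemma running_one : (stateAt vmax ρ T v p 1).running := trivial

lemma entered_one : Entered vmax ρ T v p 1 := ⟨trivial, Or.inl rfl⟩

lemma act_one : act vmax ρ T v p 1 = 1 := if_pos entered_one

open Classical in
lemma observed_eq {t : ℕ} (ht : 1 ≤ t) :
    (stateAt vmax ρ T v p t).observed = (Finset.Ico 1 t).filter (Entered vmax ρ T v p) := by
  induction t, ht using Nat.le_induction with
  | base => simp [stateAt, init]
  | succ t ht ih =>
    rw [← Finset.insert_Ico_right_eq_Ico_add_one ht, Finset.filter_insert, ← ih]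
    by_cases hr : (stateAt vmax ρ T v p t).running
    · rw [stateAt_succ ht, step, if_pos hr]
      rfl
    · rw [stateAt_succ_of_not_running ht hr, if_neg fun h => hr h.running]

lemma card_observed_eq {t : ℕ} (ht : 1 ≤ t) :
    ((stateAt vmax ρ T v p t).observed.card : ℝ) =
      ∑ i ∈ Finset.Ico 1 t, act vmax ρ T v p i := by
  classical
  rw [observed_eq ht, Finset.card_filter]
  push_cast
  exact Finset.sum_congr rfl fun i _ => by unfold act; congr

lemma sum_observed_eq {t : ℕ} (ht : 1 ≤ t) (f : ℕ → ℝ) :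
    ∑ i ∈ (stateAt vmax ρ T v p t).observed, f i =
      ∑ i ∈ Finset.Ico 1 t, act vmax ρ T v p i * f i := by
  classical
  rw [observed_eq ht, Finset.sum_filter]
  exact Finset.sum_congr rfl fun i _ => by unfold act; split_ifs <;> simp

lemma one_le_card_observed {t : ℕ} (ht : 2 ≤ t) :
    (1 : ℝ) ≤ ((stateAt vmax ρ T v p t).observed.card : ℝ) := by
  rw [card_observed_eq (by omega), ← act_one (vmax := vmax) (ρ := ρ) (T := T) (v := v) (p := p)]
  exact Finset.single_le_sum (fun i _ => act_nonneg i) (by simp; omega)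

lemma budget_succ {t : ℕ} (ht : 1 ≤ t) :
    (stateAt vmax ρ T v p (t + 1)).budget =
      (stateAt vmax ρ T v p t).budget - act vmax ρ T v p t * cost (v t) (p t) := by
  by_cases hr : (stateAt vmax ρ T v p t).running
  · rw [stateAt_succ ht, step, if_pos hr]
    rfl
  · rw [stateAt_succ_of_not_running ht hr, act_eq_zero_of_not_running hr]
    ring

lemma budget_eq (n : ℕ) :
    (stateAt vmax ρ T v p (n + 1)).budget =
      ρ * T - ∑ t ∈ Finset.Icc 1 n, act vmax ρ T v p t * cost (v t) (p t) := by
  induction n with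
  | zero => simp [stateAt, init]
  | succ n ih => rw [budget_succ (by omega), ih, Finset.sum_Icc_succ_top (by omega)]; ring

lemma budget_lt_of_not_running {t : ℕ} (ht : 1 ≤ t)
    (h : ¬ (stateAt vmax ρ T v p t).running) : (stateAt vmax ρ T v p t).budget < vmax := by
  induction t, ht using Nat.le_induction with
  | base => exact absurd running_one h
  | succ t ht ih =>
    by_cases hr : (stateAt vmax ρ T v p t).running
    · rw [stateAt_succ ht, step, if_pos hr] at h ⊢
      exact not_not.1 h
    · rw [stateAt_succ_of_not_running ht hr]
      exact ih hr

lemma lam_two : (stateAt vmax ρ T v p 2).lam = 0 := by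
  rw [stateAt_succ le_rfl, step, if_pos running_one]
  rfl

/-- The update direction of the pricing parameter in round `t`. -/
noncomputable def grad (vmax ρ : ℝ) (T : ℕ) (v p : ℕ → ℝ) (t : ℕ) : ℝ :=
  act vmax ρ T v p t * estCost T p (stateAt vmax ρ T v p t).observed (v t) - ρ

lemma lam_succ {t : ℕ} (ht : 2 ≤ t) (h : (stateAt vmax ρ T v p t).running) :
    (stateAt vmax ρ T v p (t + 1)).lam =
      max ((stateAt vmax ρ T v p t).lam + stepSize vmax t * grad vmax ρ T v p t) 0 := by
  rw [stateAt_succ (by omega), step, if_pos h]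
  simp only
  rw [if_neg (by omega)]
  rfl

lemma lam_nonneg (t : ℕ) : 0 ≤ (stateAt vmax ρ T v p t).lam := by
  match t with
  | 0 => exact le_rfl
  | 1 => exact le_rfl
  | 2 => exact lam_two.ge
  | t + 3 =>
    by_cases hr : (stateAt vmax ρ T v p (t + 2)).running
    · rw [lam_succ (by omega) hr]
      exact le_max_right _ _
    · rw [stateAt_succ_of_not_running (by omega) hr]
      exact lam_nonneg (t + 2)

lemma stepSize_mul_vmax (hV : 0 < vmax) (t : ℕ) :
    stepSize vmax t * vmax = 1 / Real.sqrt t := by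
  unfold stepSize
  rcases eq_or_ne (Real.sqrt t) 0 with h | h
  · simp [h]
  · field_simp

lemma stepSize_nonneg (hV : 0 < vmax) (t : ℕ) : 0 ≤ stepSize vmax t := by
  unfold stepSize; positivity

/-! ### Entering frequency and boundedness of the pricing parameter. -/

section Bounded

variable (hv : ∀ t, v t ∈ Set.Icc 0 vmax) (hp : ∀ t, p t ∈ Set.Icc 0 vmax)

lemma avg_le {I : Finset ℕ} {f : ℕ → ℝ} {w : ℝ} (hw : 0 ≤ w) (hf : ∀ i, f i ≤ w) :
    (∑ i ∈ I, f i) / (I.card : ℝ) ≤ w := by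
  refine div_le_of_le_mul₀ (Nat.cast_nonneg _) hw ?_
  calc ∑ i ∈ I, f i ≤ ∑ _i ∈ I, w := Finset.sum_le_sum fun i _ => hf i
    _ = w * I.card := by simp [mul_comm]

include hv

lemma estRev_nonneg (I : Finset ℕ) (t : ℕ) : 0 ≤ estRev T p I (v t) := by
  unfold estRev
  have h1 : 0 ≤ ∑ i ∈ I, rev (v t) (p i) := Finset.sum_nonneg fun i _ => rev_nonneg _ _
  have h2 := radius_nonneg T I
  have h3 := (hv t).1
  positivity

lemma estCost_le (I : Finset ℕ) (t : ℕ) : estCost T p I (v t) ≤ (1 - 2 * radius T I) * v t := by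
  unfold estCost
  have := avg_le (I := I) (f := fun i => cost (v t) (p i)) (hv t).1
    fun i => cost_le (hv t).1
  linarith

lemma estCost_le_vmax (I : Finset ℕ) (t : ℕ) : estCost T p I (v t) ≤ vmax := by
  refine (estCost_le hv I t).trans ?_
  have h1 := mul_nonneg (radius_nonneg T I) (hv t).1
  have h2 := (hv t).2
  nlinarith

/-- At price zero the test only asks for a nonnegative estimated revenue. Hence the window opened by
a zero of `λ` always contains an entered round. -/
lemma entered_of_lam_eq_zero {t : ℕ} (h : (stateAt vmax ρ T v p t).running)
    (h0 : (stateAt vmax ρ T v p t).lam = 0) : Entered vmax ρ T v p t :=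
  ⟨h, Or.inr (by rw [h0, zero_mul]; exact estRev_nonneg hv _ t)⟩

lemma stepSize_mul_grad_le (hV : 0 < vmax) (t : ℕ) :
    stepSize vmax t * grad vmax ρ T v p t ≤
      (act vmax ρ T v p t - ρ / vmax) * (1 / Real.sqrt t) := by
  rw [← stepSize_mul_vmax hV t]
  have h1 := mul_le_mul_of_nonneg_left (estCost_le_vmax (T := T) (p := p) hv
    (stateAt vmax ρ T v p t).observed t) (act_nonneg (vmax := vmax) (ρ := ρ) (T := T)
    (v := v) (p := p) t)
  have h2 : (act vmax ρ T v p t - ρ / vmax) * (stepSize vmax t * vmax) =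
      stepSize vmax t * (act vmax ρ T v p t * vmax - ρ) := by field_simp
  rw [h2]
  exact mul_le_mul_of_nonneg_left (by unfold grad; linarith) (stepSize_nonneg hV t)

/-- As long as `λ` stays away from zero after round `s`, the projection does nothing and the updates
simply add up. -/
lemma lam_add_le (hV : 0 < vmax) {s n m : ℕ} (hs : 2 ≤ s) (hm : s + m ≤ n)
    (hrun : (stateAt vmax ρ T v p n).running)
    (h0 : (stateAt vmax ρ T v p s).lam = 0)
    (hpos : ∀ i, s < i → i ≤ n → (stateAt vmax ρ T v p i).lam ≠ 0) :
    (stateAt vmax ρ T v p (s + m)).lam ≤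
      ∑ i ∈ Finset.range m, (act vmax ρ T v p (s + i) - ρ / vmax) *
        (1 / Real.sqrt ((s + i : ℕ) : ℝ)) := by
  induction m with
  | zero => simp [h0]
  | succ m ih =>
    have hr := running_of_le (by omega) (show s + m ≤ n by omega) hrun
    have hne := hpos (s + (m + 1)) (by omega) hm
    rw [← add_assoc, lam_succ (by omega) hr] at hne ⊢
    rw [Finset.sum_range_succ]
    have h1 := ih (by omega)
    have h2 := stepSize_mul_grad_le (ρ := ρ) (T := T) (p := p) hv hV (s + m)
    rw [max_eq_left (le_of_not_ge fun h => hne (max_eq_right h))]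
    linarith

lemma half_sq_mul_le_card_observed (hρ : 0 < ρ) (hρv : ρ ≤ vmax) (n : ℕ) (hn : 1 ≤ n)
    (hrun : (stateAt vmax ρ T v p n).running) :
    (1 / 2) * (ρ / vmax) ^ 2 * n ≤ ((stateAt vmax ρ T v p (n + 1)).observed.card : ℝ) := by
  classical
  have hV : 0 < vmax := hρ.trans_le hρv
  have ha0 : 0 < ρ / vmax := div_pos hρ hV
  have ha1 : ρ / vmax ≤ 1 := (div_le_one hV).2 hρv
  have ha2 : (ρ / vmax) ^ 2 ≤ 1 := pow_le_one₀ ha0.le ha1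
  induction n using Nat.strong_induction_on with
  | _ n IH =>
  rcases hn.eq_or_lt with rfl | hn2
  · refine le_trans ?_ (one_le_card_observed le_rfl)
    push_cast
    linarith
  -- The last zero of `λ` up to round `n`. It is at least `2` because exploration leaves `λ_2 = 0`,
  -- so the induction hypothesis applies at `s - 1 ≥ 1`.
  set s := Nat.findGreatest (fun i => (stateAt vmax ρ T v p i).lam = 0) n
  have hs2 : 2 ≤ s := Nat.le_findGreatest hn2 lam_two
  have hsn : s ≤ n := Nat.findGreatest_le n
  have hs0 : (stateAt vmax ρ T v p s).lam = 0 :=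
    Nat.findGreatest_spec (P := fun i => (stateAt vmax ρ T v p i).lam = 0) hn2 lam_two
  have hpos : ∀ i, s < i → i ≤ n → (stateAt vmax ρ T v p i).lam ≠ 0 := fun i h1 h2 =>
    Nat.findGreatest_is_greatest (P := fun i => (stateAt vmax ρ T v p i).lam = 0) h1 h2
  obtain ⟨l, hl⟩ := Nat.exists_eq_add_of_le hsn
  have hprev := IH (s - 1) (by omega) (by omega)
    (running_of_le (by omega) (by omega) hrun)
  rw [show s - 1 + 1 = s by omega, Nat.cast_sub (by omega), observed_eq (by omega)] at hprev
  have hlam := lam_add_le hv hV hs2 hl.ge hrun hs0 hpos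
  have hsum : ρ / vmax * invSqrtSum s l ≤
      ∑ i ∈ (Finset.range l).filter (fun i => Entered vmax ρ T v p (s + i)),
        1 / Real.sqrt ((s + i : ℕ) : ℝ) := by
    rw [Finset.sum_filter, invSqrtSum, Finset.mul_sum]
    have h0 := (lam_nonneg _).trans hlam
    rw [← sub_nonneg, ← Finset.sum_sub_distrib]
    refine h0.trans_eq (Finset.sum_congr rfl fun i _ => ?_)
    unfold act
    split_ifs <;> ring
  have hcount := sq_mul_le_card_filter (by omega) _ l ha0.le hsum
  have hunion : (Finset.Ico 1 s).filter (Entered vmax ρ T v p) ∪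
      (Finset.Ico s (n + 1)).filter (Entered vmax ρ T v p) =
      (Finset.Ico 1 (n + 1)).filter (Entered vmax ρ T v p) := by
    rw [← Finset.filter_union, Finset.Ico_union_Ico_eq_Ico (by omega) (by omega)]
  have hdisj : Disjoint ((Finset.Ico 1 s).filter (Entered vmax ρ T v p))
      ((Finset.Ico s (n + 1)).filter (Entered vmax ρ T v p)) :=
    Finset.disjoint_filter_filter (Finset.Ico_disjoint_Ico_consecutive _ _ _)
  rw [observed_eq (by omega), ← hunion, Finset.card_union_of_disjoint hdisj]
  have hone : 1 ≤ ((Finset.Ico s (n + 1)).filter (Entered vmax ρ T v p)).card :=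
    Finset.card_pos.2 ⟨s, Finset.mem_filter.2 ⟨by simp; omega,
      entered_of_lam_eq_zero hv (running_of_le (by omega) hsn hrun) hs0⟩⟩
  have hk : ((Finset.range l).filter (fun i => Entered vmax ρ T v p (s + i))).card ≤
      ((Finset.Ico s (n + 1)).filter (Entered vmax ρ T v p)).card := by
    refine Finset.card_le_card_of_injOn (fun i => s + i) ?_ (fun _ _ _ _ h => by simpa using h)
    intro i hi
    simp only [Finset.coe_filter, Finset.mem_range, Set.mem_ofPred_eq, Finset.mem_Ico] at hi ⊢
    exact ⟨by omega, hi.2⟩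
  have hone' : (1 : ℝ) ≤ ((Finset.Ico s (n + 1)).filter (Entered vmax ρ T v p)).card := by
    exact_mod_cast hone
  have hk' : (((Finset.range l).filter (fun i => Entered vmax ρ T v p (s + i))).card : ℝ) ≤
      ((Finset.Ico s (n + 1)).filter (Entered vmax ρ T v p)).card := by exact_mod_cast hk
  have hn' : (n : ℝ) = s + l := by exact_mod_cast hl
  push_cast at hprev ⊢
  rw [hn']
  -- The window holds at least `max 1 (a² l) ≥ 1/2 + a² l / 2` entered rounds; since `a ≤ 1`, the
  -- `1/2` covers the `a²/2` that the induction hypothesis at `s - 1` lacks. This is where the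
  -- factor `1/2` in the frequency originates.
  nlinarith

lemma freqConst_mul_le_card_observed (hρ : 0 < ρ) (hρv : ρ ≤ vmax) (t : ℕ) (ht : 2 ≤ t)
    (hrun : (stateAt vmax ρ T v p (t - 1)).running) :
    freqConst vmax ρ * ((t : ℝ) - 1) ≤ ((stateAt vmax ρ T v p t).observed.card : ℝ) := by
  have h := half_sq_mul_le_card_observed hv hρ hρv (t - 1) (by omega) hrun
  rw [show t - 1 + 1 = t by omega, Nat.cast_sub (by omega)] at h
  refine le_trans (mul_le_mul_of_nonneg_right (min_le_left _ _) ?_) (by exact_mod_cast h)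
  have : (2 : ℝ) ≤ t := by exact_mod_cast ht
  linarith

include hp

lemma estRev_le (I : Finset ℕ) (t : ℕ) : estRev T p I (v t) ≤ (1 + radius T I) * v t := by
  unfold estRev
  have := avg_le (I := I) (f := fun i => rev (v t) (p i)) (hv t).1
    fun i => rev_le (hv t).1 (hp i).1
  linarith

/-- Only a positive update direction matters. It requires an entered round with estimated cost above
`ρ`, and then the entering test itself bounds `λ ρ` by the estimated revenue. The summand `1` is the
largest possible step. -/
lemma lam_le (hρ : 0 < ρ) (hρv : ρ ≤ vmax) (t : ℕ) :
    (stateAt vmax ρ T v p t).lam ≤ 3 / 2 * (vmax / ρ) + 1 := by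
  have hV : 0 < vmax := hρ.trans_le hρv
  have hL : 0 ≤ 3 / 2 * (vmax / ρ) + 1 := by positivity
  match t with
  | 0 => exact hL
  | 1 => exact hL
  | 2 => exact lam_two.le.trans hL
  | t + 3 =>
    have ih := lam_le hρ hρv (t + 2)
    by_cases hr : (stateAt vmax ρ T v p (t + 2)).running
    swap
    · rw [stateAt_succ_of_not_running (by omega) hr]
      exact ih
    rw [lam_succ (by omega) hr]
    refine max_le ?_ hL
    have hη := stepSize_nonneg hV (t + 2)
    by_cases hg : grad vmax ρ T v p (t + 2) ≤ 0
    · linarith [mul_nonpos_of_nonneg_of_nonpos hη hg]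
    push Not at hg
    have hent : Entered vmax ρ T v p (t + 2) := by
      by_contra hent
      simp [grad, act, hent] at hg
      linarith
    have hstep := stepSize_mul_grad_le (ρ := ρ) (T := T) (p := p) hv hV (t + 2)
    unfold grad at hg
    rw [act, if_pos hent] at hg hstep
    rcases hent.2 with h | h
    · omega
    set I := (stateAt vmax ρ T v p (t + 2)).observed
    set l := (stateAt vmax ρ T v p (t + 2)).lam
    have h1 := estCost_le (T := T) (p := p) hv I (t + 2)
    have h2 := estRev_le (T := T) hv hp I (t + 2)
    have hl : 0 ≤ l := lam_nonneg _
    have hvt := hv (t + 2)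
    have hvpos : 0 < v (t + 2) := by
      rcases hvt.1.eq_or_lt with h0 | h0
      · rw [← h0] at h1 hg; linarith
      · exact h0
    -- Otherwise the bound `(1 - 2 ε) v` on the estimated cost would be nonpositive, against its
    -- exceeding `ρ > 0`.
    have hrad : radius T I < 1 / 2 := by
      by_contra hc
      push Not at hc
      nlinarith
    have h3 : estRev T p I (v (t + 2)) ≤ 3 / 2 * vmax := by nlinarith [hvt.2]
    have h4 : l * ρ ≤ 3 / 2 * vmax := by
      have : l * ρ ≤ l * estCost T p I (v (t + 2)) := mul_le_mul_of_nonneg_left (by linarith) hl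
      linarith
    have h5 : l ≤ 3 / 2 * (vmax / ρ) := by
      rw [← mul_div_assoc, le_div_iff₀ hρ]; exact h4
    have h6 : (1 - ρ / vmax) * (1 / Real.sqrt ((t + 2 : ℕ) : ℝ)) ≤ 1 := by
      have h7 : 1 / Real.sqrt ((t + 2 : ℕ) : ℝ) ≤ 1 := by
        rw [div_le_one (Real.sqrt_pos.2 (by positivity))]
        exact Real.one_le_sqrt.2 (by push_cast; linarith [(Nat.cast_nonneg t : (0 : ℝ) ≤ t)])
      have h8 : 0 ≤ 1 / Real.sqrt ((t + 2 : ℕ) : ℝ) := by positivity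
      have h9 : 0 < ρ / vmax := div_pos hρ hV
      nlinarith
    linarith

end Bounded

end Deterministic

/-! ### Online gradient descent and the regret on a favourable input -/

section RegretDeterministic

variable {vmax ρ : ℝ} {T : ℕ} {v p : ℕ → ℝ}

lemma act_eq_zero_or_one (t : ℕ) : act vmax ρ T v p t = 0 ∨ act vmax ρ T v p t = 1 := by
  unfold act; split_ifs <;> simp

lemma alive_mul_act (t : ℕ) :
    alive vmax ρ T v p t * act vmax ρ T v p t = act vmax ρ T v p t := by
  by_cases h : (stateAt vmax ρ T v p t).running
  · rw [alive, if_pos h, one_mul]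
  · rw [act_eq_zero_of_not_running h, mul_zero]

lemma alive_one : alive vmax ρ T v p 1 = 1 := if_pos running_one

lemma sum_Icc_one_eq {n : ℕ} (hn : 1 ≤ n) (f : ℕ → ℝ) :
    ∑ t ∈ Finset.Icc 1 n, f t = f 1 + ∑ t ∈ Finset.Icc 2 n, f t := by
  rw [← Finset.insert_Icc_add_one_left_eq_Icc hn, Finset.sum_insert (by simp), one_add_one_eq_two]

/-- The regret bound of online projected gradient descent with steps `1 / (vmax √t)`. -/
lemma sum_grad_mul_le (hV : 0 < vmax) {Lam : ℝ}
    (hLam : ∀ t, (stateAt vmax ρ T v p t).lam ≤ Lam) {l : ℝ} (hl : l ∈ Set.Icc 0 Lam)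
    (n : ℕ) (hn : 1 ≤ n) :
    ∑ t ∈ Finset.Icc 2 n, alive vmax ρ T v p t *
        (grad vmax ρ T v p t * (l - (stateAt vmax ρ T v p t).lam)) ≤
      (Lam ^ 2 - ((stateAt vmax ρ T v p (n + 1)).lam - l) ^ 2) * (vmax * Real.sqrt n / 2) +
      ∑ t ∈ Finset.Icc 2 n, alive vmax ρ T v p t *
        (stepSize vmax t * grad vmax ρ T v p t ^ 2 / 2) := by
  have hdiam : ∀ t, ((stateAt vmax ρ T v p t).lam - l) ^ 2 ≤ Lam ^ 2 := fun t =>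
    sq_le_sq' (by linarith [lam_nonneg (vmax := vmax) (ρ := ρ) (T := T) (v := v) (p := p) t, hl.2])
      (by linarith [hLam t, hl.1])
  induction n, hn using Nat.le_induction with
  | base =>
    simp only [Finset.Icc_eq_empty (show ¬ (2 : ℕ) ≤ 1 by omega), Finset.sum_empty, add_zero]
    exact mul_nonneg (sub_nonneg.2 (hdiam _)) (by positivity)
  | succ n hn ih =>
    rw [Finset.sum_Icc_succ_top (by omega), Finset.sum_Icc_succ_top (by omega)]
    set x := (stateAt vmax ρ T v p (n + 1)).lam with hx
    set y := (stateAt vmax ρ T v p (n + 1 + 1)).lam with hy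
    set g := grad vmax ρ T v p (n + 1)
    have hmono : vmax * Real.sqrt n / 2 ≤ vmax * Real.sqrt ((n + 1 : ℕ) : ℝ) / 2 := by
      gcongr; omega
    -- The inverse step size `vmax √t` grows. Keeping the nonnegative slack `Lam² - (λ - l)²` in the
    -- induction absorbs this growth, as in summation by parts.
    have hd := mul_le_mul_of_nonneg_left hmono (sub_nonneg.2 (hdiam (n + 1)))
    rw [← hx] at hd
    have hs0 : 0 < Real.sqrt ((n + 1 : ℕ) : ℝ) := Real.sqrt_pos.2 (by positivity)
    have key : alive vmax ρ T v p (n + 1) * (g * (l - x)) ≤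
        ((x - l) ^ 2 - (y - l) ^ 2) * (vmax * Real.sqrt ((n + 1 : ℕ) : ℝ) / 2) +
        alive vmax ρ T v p (n + 1) * (stepSize vmax (n + 1) * g ^ 2 / 2) := by
      by_cases hr : (stateAt vmax ρ T v p (n + 1)).running
      · rw [alive, if_pos hr, one_mul, one_mul]
        have hyx : y = max (x + stepSize vmax (n + 1) * g) 0 := lam_succ (by omega) hr
        have hsq : (y - l) ^ 2 ≤ (x + stepSize vmax (n + 1) * g - l) ^ 2 := by
          rw [hyx]
          rcases le_total 0 (x + stepSize vmax (n + 1) * g) with h | h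
          · rw [max_eq_left h]
          · rw [max_eq_right h]
            nlinarith [hl.1]
        have hη : stepSize vmax (n + 1) * (vmax * Real.sqrt ((n + 1 : ℕ) : ℝ)) = 1 := by
          unfold stepSize
          field_simp
        set s := vmax * Real.sqrt ((n + 1 : ℕ) : ℝ)
        set η := stepSize vmax (n + 1)
        have hs : 0 < s := mul_pos hV hs0
        have h1 := mul_le_mul_of_nonneg_right hsq (half_pos hs).le
        have h2 : (x + η * g - l) ^ 2 * (s / 2) =
            (x - l) ^ 2 * (s / 2) + (η * s) * (g * (x - l)) + (η * s) * (η * g ^ 2 / 2) := by ring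
        rw [h2, hη] at h1
        linarith
      · rw [alive, if_neg hr, show y = x by rw [hy, hx, stateAt_succ_of_not_running (by omega) hr]]
        simp
    linarith

/-- Some comparator `l` makes the dual term compensate for the
rounds that are lost after the stopping time. -/
lemma exists_comparator (hρ : 0 < ρ) (hρv : ρ ≤ vmax) (hv : ∀ t, v t ∈ Set.Icc 0 vmax)
    (hT : 1 ≤ T) {E : ℝ}
    (hE0 : 0 ≤ E)
    (hE : ∑ t ∈ Finset.Icc 2 T, act vmax ρ T v p t * cost (v t) (p t) ≤
      ∑ t ∈ Finset.Icc 2 T, act vmax ρ T v p t *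
        estCost T p (stateAt vmax ρ T v p t).observed (v t) + E) :
    ∃ l ∈ Set.Icc 0 (vmax / ρ),
      vmax * (T - ∑ t ∈ Finset.Icc 1 T, alive vmax ρ T v p t) - vmax / ρ * (2 * vmax + E) ≤
        l * ∑ t ∈ Finset.Icc 2 T, alive vmax ρ T v p t * grad vmax ρ T v p t := by
  have hV : 0 < vmax := hρ.trans_le hρv
  by_cases hr : (stateAt vmax ρ T v p (T + 1)).running
  · refine ⟨0, ⟨le_rfl, by positivity⟩, ?_⟩
    have : ∑ t ∈ Finset.Icc 1 T, alive vmax ρ T v p t = T := by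
      rw [Finset.sum_congr rfl fun t ht => show alive vmax ρ T v p t = 1 from
        if_pos (running_of_le (Finset.mem_Icc.1 ht).1 (by linarith [(Finset.mem_Icc.1 ht).2]) hr)]
      simp
    rw [this, sub_self, mul_zero, zero_sub, zero_mul, neg_nonpos]
    positivity
  -- The budget ran out, so the realized costs nearly reach `ρ T`. Of the `2 vmax`, one covers the
  -- budget left at the break and the other the cost of round `1`, which lies outside the sums from
  -- `2`.
  · refine ⟨vmax / ρ, ⟨by positivity, le_rfl⟩, ?_⟩
    have hb := budget_lt_of_not_running (by omega) hr
    rw [budget_eq, sum_Icc_one_eq hT, act_one] at hb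
    have hc : cost (v 1) (p 1) ≤ vmax := (cost_le (hv 1).1).trans (hv 1).2
    have hg : ∑ t ∈ Finset.Icc 2 T, alive vmax ρ T v p t * grad vmax ρ T v p t =
        ∑ t ∈ Finset.Icc 2 T, act vmax ρ T v p t *
          estCost T p (stateAt vmax ρ T v p t).observed (v t) -
        ρ * ∑ t ∈ Finset.Icc 2 T, alive vmax ρ T v p t := by
      rw [Finset.mul_sum, ← Finset.sum_sub_distrib]
      refine Finset.sum_congr rfl fun t _ => ?_
      rw [grad, mul_sub, ← mul_assoc, alive_mul_act, mul_comm ρ]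
    rw [hg, sum_Icc_one_eq hT, alive_one]
    set N := ∑ t ∈ Finset.Icc 2 T, alive vmax ρ T v p t
    have h1 : ρ * (T - (1 + N)) - (2 * vmax + E) ≤
        ∑ t ∈ Finset.Icc 2 T, act vmax ρ T v p t *
          estCost T p (stateAt vmax ρ T v p t).observed (v t) - ρ * N := by
      linarith
    have h2 := mul_le_mul_of_nonneg_left h1 (div_nonneg hV.le hρ.le)
    have h3 : vmax / ρ * (ρ * (T - (1 + N)) - (2 * vmax + E)) =
        vmax * (T - (1 + N)) - vmax / ρ * (2 * vmax + E) := by field_simp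
    linarith

/-- The entering decision maximizes the estimated Lagrangian. -/
lemma act_mul_estimate_ge {t : ℕ} (ht : 2 ≤ t) (hr : (stateAt vmax ρ T v p t).running) {q : ℝ}
    (hq : q ∈ Set.Icc (0 : ℝ) 1) :
    q * (estRev T p (stateAt vmax ρ T v p t).observed (v t) -
      (stateAt vmax ρ T v p t).lam * estCost T p (stateAt vmax ρ T v p t).observed (v t)) ≤
    act vmax ρ T v p t * (estRev T p (stateAt vmax ρ T v p t).observed (v t) -
      (stateAt vmax ρ T v p t).lam * estCost T p (stateAt vmax ρ T v p t).observed (v t)) := by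
  unfold act
  split_ifs with h
  · rcases h.2 with h1 | h1
    · omega
    · nlinarith [hq.2]
  · have h1 : ¬ (estRev T p (stateAt vmax ρ T v p t).observed (v t) ≥
      (stateAt vmax ρ T v p t).lam * estCost T p (stateAt vmax ρ T v p t).observed (v t)) :=
      fun h1 => h ⟨hr, Or.inr h1⟩
    push Not at h1
    nlinarith [hq.1]

/-- Replacing estimates by means costs `β` for the revenue of the decision, `β` for the revenue of
the policy, and `Lam β` for the cost of the policy. The cost of the decision needs no replacement:
it stays estimated inside `grad`, which is what gradient descent sees. -/
lemma act_mul_mean_ge {t : ℕ} (ht : 2 ≤ t) {Lam β q r c : ℝ}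
    (hLam : (stateAt vmax ρ T v p t).lam ≤ Lam) (hq : q ∈ Set.Icc (0 : ℝ) 1) (hβ : 0 ≤ β)
    (hr : (stateAt vmax ρ T v p t).running →
      |estRev T p (stateAt vmax ρ T v p t).observed (v t) - r| ≤ β)
    (hc : (stateAt vmax ρ T v p t).running →
      |estCost T p (stateAt vmax ρ T v p t).observed (v t) - c| ≤ β) :
    alive vmax ρ T v p t * (q * r) -
      alive vmax ρ T v p t * ((stateAt vmax ρ T v p t).lam * (q * c - ρ)) +
      alive vmax ρ T v p t * ((stateAt vmax ρ T v p t).lam * grad vmax ρ T v p t) -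
      (2 + Lam) * β ≤ act vmax ρ T v p t * r := by
  have hl0 := lam_nonneg (vmax := vmax) (ρ := ρ) (T := T) (v := v) (p := p) t
  by_cases hrun : (stateAt vmax ρ T v p t).running
  · have h1 := act_mul_estimate_ge ht hrun hq
    have h2 := abs_le.1 (hr hrun)
    have h3 := abs_le.1 (hc hrun)
    have hx0 := act_nonneg (vmax := vmax) (ρ := ρ) (T := T) (v := v) (p := p) t
    have hx1 := act_le_one (vmax := vmax) (ρ := ρ) (T := T) (v := v) (p := p) t
    rw [alive, if_pos hrun, grad]
    set x := act vmax ρ T v p t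
    set l := (stateAt vmax ρ T v p t).lam
    set R := estRev T p (stateAt vmax ρ T v p t).observed (v t)
    set K := estCost T p (stateAt vmax ρ T v p t).observed (v t)
    have h4 : x * (R - r) ≤ β := by nlinarith
    have h5 : -β ≤ q * (R - r) := by nlinarith [hq.1, hq.2]
    have h6 : q * (K - c) ≤ β := by nlinarith [hq.1, hq.2]
    have h7 : l * (q * (K - c)) ≤ Lam * β :=
      (mul_le_mul_of_nonneg_left h6 hl0).trans (mul_le_mul_of_nonneg_right hLam hβ)
    linarith
  · rw [alive, if_neg hrun, act_eq_zero_of_not_running hrun]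
    have : 0 ≤ (2 + Lam) * β := mul_nonneg (by linarith) hβ
    linarith

/-- The constant of the regret bound, for pricing parameters at most `Lam` and confidence
radii `κ √(ln T) / √t`. -/
noncomputable def regretConst (vmax Lam κ : ℝ) : ℝ :=
  3 * vmax + (2 + Lam) * (3 * vmax) + Lam ^ 2 * vmax + (4 * vmax + 3 * κ ^ 2 / vmax) +
    (2 + Lam) * (2 * κ) + Lam * (3 * vmax + 3 * vmax + 2 * κ)

/-- The estimated cost may be negative because of the confidence term, so the lower bound comes from
its closeness to a nonnegative mean. -/
lemma abs_grad_le (hV : ρ ≤ vmax) (hρ : 0 < ρ) (hv : ∀ t, v t ∈ Set.Icc 0 vmax) {t : ℕ} {β c : ℝ}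
    (hβ : 0 ≤ β) (hc0 : 0 ≤ c)
    (hc : |estCost T p (stateAt vmax ρ T v p t).observed (v t) - c| ≤ β) :
    |grad vmax ρ T v p t| ≤ vmax + β := by
  have h1 := estCost_le_vmax (T := T) (p := p) hv (stateAt vmax ρ T v p t).observed t
  have h2 := (abs_le.1 hc).1
  unfold grad
  rcases act_eq_zero_or_one (vmax := vmax) (ρ := ρ) (T := T) (v := v) (p := p) t with h | h
  all_goals
    rw [h, abs_le]
    constructor <;> linarith

/-- The quantities that must be controlled when the regret is small: `mr` and `mc` are the mean
revenue and the mean cost at a given value, `π` is a feasible throttling policy with mean revenue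
`R` and mean cost `K`. -/
structure Favourable (vmax ρ : ℝ) (T : ℕ) (v p : ℕ → ℝ) (mr mc π : ℝ → ℝ) (R K Lam κ : ℝ) :
    Prop where
  estRev_close : ∀ t ∈ Finset.Icc 2 T, (stateAt vmax ρ T v p t).running →
    |estRev T p (stateAt vmax ρ T v p t).observed (v t) - mr (v t)| ≤
      κ * Real.sqrt (Real.log T) * (1 / Real.sqrt t)
  estCost_close : ∀ t ∈ Finset.Icc 2 T, (stateAt vmax ρ T v p t).running →
    |estCost T p (stateAt vmax ρ T v p t).observed (v t) - mc (v t)| ≤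
      κ * Real.sqrt (Real.log T) * (1 / Real.sqrt t)
  revenue_close : ∑ t ∈ Finset.Icc 1 T, act vmax ρ T v p t * (mr (v t) - rev (v t) (p t)) ≤
    3 * vmax * Real.sqrt (T * Real.log T)
  cost_close : ∑ t ∈ Finset.Icc 1 T, act vmax ρ T v p t * (cost (v t) (p t) - mc (v t)) ≤
    3 * vmax * Real.sqrt (T * Real.log T)
  policy_revenue : ∑ t ∈ Finset.Icc 1 T, alive vmax ρ T v p t * (R - π (v t) * mr (v t)) ≤
    3 * vmax * Real.sqrt (T * Real.log T)
  policy_cost : ∑ t ∈ Finset.Icc 1 T, alive vmax ρ T v p t *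
      ((stateAt vmax ρ T v p t).lam * (π (v t) * mc (v t) - K)) ≤
    Lam * (3 * vmax * Real.sqrt (T * Real.log T))

/-- These let constants, `√T` and `ln T` all be absorbed into `√(T ln T)`; the first fails at `T =
1`. -/
lemma sqrt_log_facts (hT : 2 ≤ T) :
    1 ≤ Real.sqrt (T * Real.log T) ∧ Real.sqrt T ≤ 2 * Real.sqrt (T * Real.log T) ∧
      Real.log T ≤ Real.sqrt (T * Real.log T) ∧
      Real.sqrt (Real.log T) * Real.sqrt T = Real.sqrt (T * Real.log T) ∧
      Real.log 2 ≤ Real.log T := by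
  have hT' : (2 : ℝ) ≤ T := by exact_mod_cast hT
  have h2 : Real.log 2 ≤ Real.log T := Real.log_le_log (by norm_num) hT'
  have h3 := Real.log_two_gt_d9
  have h4 : Real.log T ≤ T := (Real.log_le_sub_one_of_pos (by linarith)).trans (by linarith)
  refine ⟨?_, ?_, ?_, ?_, h2⟩
  · rw [Real.one_le_sqrt]; nlinarith
  · have : (2 : ℝ) = Real.sqrt 4 := by
      rw [show (4 : ℝ) = 2 ^ 2 by norm_num, Real.sqrt_sq (by norm_num)]
    rw [this, ← Real.sqrt_mul (by norm_num)]
    exact Real.sqrt_le_sqrt (by nlinarith)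
  · exact Real.le_sqrt_of_sq_le (by nlinarith)
  · rw [mul_comm, ← Real.sqrt_mul (by linarith)]

/-- On a favourable input the revenue is at least that of the policy, up to `O(√(T ln T))`. -/
lemma Favourable.regret_le (hρ : 0 < ρ) (hρv : ρ ≤ vmax) (hT : 2 ≤ T)
    (hv : ∀ t, v t ∈ Set.Icc 0 vmax) (hp : ∀ t, p t ∈ Set.Icc 0 vmax)
    {mr mc π : ℝ → ℝ} {R K Lam κ : ℝ}
    (hmr : ∀ t, mr (v t) ∈ Set.Icc 0 vmax) (hmc : ∀ t, mc (v t) ∈ Set.Icc 0 vmax)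
    (hπ : ∀ w, π w ∈ Set.Icc (0 : ℝ) 1) (hR : R ∈ Set.Icc 0 vmax) (hK : K ≤ ρ) (hκ : 0 ≤ κ)
    (hLam : ∀ t, (stateAt vmax ρ T v p t).lam ≤ Lam) (hLam' : vmax / ρ ≤ Lam)
    (h : Favourable vmax ρ T v p mr mc π R K Lam κ) :
    T * R - ∑ t ∈ Finset.Icc 1 T, act vmax ρ T v p t * rev (v t) (p t) ≤
      regretConst vmax Lam κ * Real.sqrt (T * Real.log T) := by
  have hV : 0 < vmax := hρ.trans_le hρv
  obtain ⟨hQ1, hQT, hQL, hQ, -⟩ := sqrt_log_facts hT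
  set Q := Real.sqrt (T * Real.log T)
  set β : ℕ → ℝ := fun t => κ * Real.sqrt (Real.log T) * (1 / Real.sqrt t) with hβdef
  have hβ0 : ∀ t, 0 ≤ β t := fun t => by positivity
  have hLam0 : 0 ≤ Lam := le_trans (by positivity) hLam'
  have hlog : 0 ≤ Real.log T := Real.log_natCast_nonneg T
  have hsub : ∀ f : ℕ → ℝ, (∀ t, 0 ≤ f t) →
      ∑ t ∈ Finset.Icc 2 T, f t ≤ ∑ t ∈ Finset.Icc 1 T, f t := fun f hf =>
    Finset.sum_le_sum_of_subset_of_nonneg (Finset.Icc_subset_Icc_left (by omega)) fun t _ _ => hf t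
  have hB : ∑ t ∈ Finset.Icc 2 T, β t ≤ 2 * κ * Q := by
    refine (hsub _ hβ0).trans ?_
    rw [← Finset.mul_sum]
    have := mul_le_mul_of_nonneg_left (sum_inv_sqrt_le T)
      (by positivity : 0 ≤ κ * Real.sqrt (Real.log T))
    refine this.trans_eq ?_
    rw [← hQ]; ring
  -- the optimality of the decisions, summed over the rounds
  have hsum := Finset.sum_le_sum fun t (ht : t ∈ Finset.Icc 2 T) =>
    act_mul_mean_ge (Finset.mem_Icc.1 ht).1 (hLam t) (hπ (v t)) (hβ0 t)
      (h.estRev_close t ht) (h.estCost_close t ht)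
  simp only [Finset.sum_sub_distrib, Finset.sum_add_distrib, ← Finset.mul_sum] at hsum
  have hrev := h.revenue_close
  have hcost := h.cost_close
  have hpr := h.policy_revenue
  have hpc := h.policy_cost
  -- Round `1` is split off because it is entered without a test; each of its contributions is at
  -- most `vmax`, and its dual term vanishes with `λ_1 = 0`.
  rw [sum_Icc_one_eq (by omega)] at hrev hcost hpr hpc
  rw [act_one, one_mul] at hrev hcost
  rw [alive_one, one_mul] at hpr hpc
  rw [show (stateAt vmax ρ T v p 1).lam = 0 from rfl, zero_mul, zero_add] at hpc
  have hrev1 : rev (v 1) (p 1) ≤ vmax := (rev_le (hv 1).1 (hp 1).1).trans (hv 1).2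
  have hcost1 := cost_nonneg (v := v 1) (hp 1).1
  have hπr1 : π (v 1) * mr (v 1) ≤ vmax := by
    nlinarith [(hπ (v 1)).1, (hπ (v 1)).2, (hmr 1).1, (hmr 1).2]
  have hrev' : ∑ t ∈ Finset.Icc 2 T, act vmax ρ T v p t * mr (v t) ≤
      ∑ t ∈ Finset.Icc 2 T, act vmax ρ T v p t * rev (v t) (p t) + (3 * vmax * Q + vmax) := by
    simp only [mul_sub, Finset.sum_sub_distrib] at hrev
    linarith [(hmr 1).1]
  have hpr' : (∑ t ∈ Finset.Icc 2 T, alive vmax ρ T v p t) * R - (3 * vmax * Q + vmax) ≤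
      ∑ t ∈ Finset.Icc 2 T, alive vmax ρ T v p t * (π (v t) * mr (v t)) := by
    simp only [mul_sub, Finset.sum_sub_distrib, ← Finset.sum_mul] at hpr
    linarith [hR.1]
  have hpc' : ∑ t ∈ Finset.Icc 2 T, alive vmax ρ T v p t *
      ((stateAt vmax ρ T v p t).lam * (π (v t) * mc (v t) - ρ)) ≤ Lam * (3 * vmax * Q) := by
    refine le_trans (Finset.sum_le_sum fun t _ => ?_) hpc
    exact mul_le_mul_of_nonneg_left (mul_le_mul_of_nonneg_left (by linarith) (lam_nonneg t))
      (alive_nonneg t)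
  -- the cost estimates dominate the costs
  have hcost' : ∑ t ∈ Finset.Icc 2 T, act vmax ρ T v p t * cost (v t) (p t) ≤
      ∑ t ∈ Finset.Icc 2 T, act vmax ρ T v p t *
        estCost T p (stateAt vmax ρ T v p t).observed (v t) +
        (3 * vmax * Q + vmax + 2 * κ * Q) := by
    have h1 : ∑ t ∈ Finset.Icc 2 T, act vmax ρ T v p t * mc (v t) ≤
        ∑ t ∈ Finset.Icc 2 T, (act vmax ρ T v p t *
          estCost T p (stateAt vmax ρ T v p t).observed (v t) + β t) := by
      refine Finset.sum_le_sum fun t ht => ?_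
      by_cases hr : (stateAt vmax ρ T v p t).running
      · have h2 := abs_le.1 (h.estCost_close t ht hr)
        have h3 := hβ0 t
        rcases act_eq_zero_or_one (vmax := vmax) (ρ := ρ) (T := T) (v := v) (p := p) t with h4 | h4
        · rw [h4]; linarith
        · rw [h4]; simp only [hβdef]; linarith
      · rw [act_eq_zero_of_not_running hr]
        linarith [hβ0 t]
    rw [Finset.sum_add_distrib] at h1
    simp only [mul_sub, Finset.sum_sub_distrib] at hcost
    linarith [(hmc 1).2]
  obtain ⟨l, hl, hcomp⟩ := exists_comparator hρ hρv hv (by omega) (by positivity) hcost'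
  -- the regret of gradient descent
  have hogd := sum_grad_mul_le hV hLam ⟨hl.1, hl.2.trans hLam'⟩ T (by omega)
  -- Since `grad² ≤ 2 vmax² + 2 β²`, the first part sums like `√T`. The error part is of order `ln T
  -- / (t √t)`, whose sum is only `O(ln T)`.
  have hsq : ∑ t ∈ Finset.Icc 2 T, alive vmax ρ T v p t *
      (stepSize vmax t * grad vmax ρ T v p t ^ 2 / 2) ≤ (4 * vmax + 3 * κ ^ 2 / vmax) * Q := by
    have h1 : ∀ t ∈ Finset.Icc 2 T, alive vmax ρ T v p t *
        (stepSize vmax t * grad vmax ρ T v p t ^ 2 / 2) ≤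
        vmax * (1 / Real.sqrt t) + κ ^ 2 * Real.log T / vmax * (1 / (t * Real.sqrt t)) := by
      intro t ht
      have ht0 : (0 : ℝ) < t := by
        have := (Finset.mem_Icc.1 ht).1
        exact_mod_cast (by omega : 0 < t)
      have hst : 0 < Real.sqrt t := Real.sqrt_pos.2 ht0
      by_cases hr : (stateAt vmax ρ T v p t).running
      · rw [alive, if_pos hr, one_mul]
        have h2 := abs_grad_le hρv hρ hv (hβ0 t) (hmc t).1 (h.estCost_close t ht hr)
        have h3 : grad vmax ρ T v p t ^ 2 ≤ 2 * vmax ^ 2 + 2 * β t ^ 2 := by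
          have := sq_le_sq' (abs_le.1 h2).1 (abs_le.1 h2).2
          nlinarith [sq_nonneg (vmax - β t)]
        have h4 : β t ^ 2 = κ ^ 2 * Real.log T * (1 / t) := by
          simp only [hβdef]
          rw [mul_pow, mul_pow, Real.sq_sqrt hlog, div_pow, Real.sq_sqrt ht0.le, one_pow]
        rw [h4] at h3
        calc stepSize vmax t * grad vmax ρ T v p t ^ 2 / 2
            ≤ stepSize vmax t * (2 * vmax ^ 2 + 2 * (κ ^ 2 * Real.log T * (1 / t))) / 2 := by
              have := mul_le_mul_of_nonneg_left h3 (stepSize_nonneg hV t)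
              linarith
          _ = _ := by unfold stepSize; field_simp
      · rw [alive, if_neg hr, zero_mul]
        positivity
    refine (Finset.sum_le_sum h1).trans ?_
    rw [Finset.sum_add_distrib, ← Finset.mul_sum, ← Finset.mul_sum]
    have h5 := (hsub (fun t => 1 / Real.sqrt t) fun t => by positivity).trans (sum_inv_sqrt_le T)
    have h6 := (hsub (fun t => 1 / (t * Real.sqrt t)) fun t => by positivity).trans
      (sum_inv_mul_sqrt_le T)
    have h7 : vmax * ∑ t ∈ Finset.Icc 2 T, 1 / Real.sqrt (t : ℝ) ≤ vmax * (4 * Q) :=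
      mul_le_mul_of_nonneg_left (by linarith) hV.le
    have h8 : κ ^ 2 * Real.log T / vmax * ∑ t ∈ Finset.Icc 2 T, 1 / ((t : ℝ) * Real.sqrt t) ≤
        κ ^ 2 * Q / vmax * 3 := by gcongr
    have h9 : κ ^ 2 * Q / vmax * 3 = 3 * κ ^ 2 / vmax * Q := by ring
    linarith
  have hogd' : ∑ t ∈ Finset.Icc 2 T, alive vmax ρ T v p t *
        (grad vmax ρ T v p t * (l - (stateAt vmax ρ T v p t).lam)) =
      l * ∑ t ∈ Finset.Icc 2 T, alive vmax ρ T v p t * grad vmax ρ T v p t -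
      ∑ t ∈ Finset.Icc 2 T, alive vmax ρ T v p t *
        ((stateAt vmax ρ T v p t).lam * grad vmax ρ T v p t) := by
    rw [Finset.mul_sum, ← Finset.sum_sub_distrib]
    exact Finset.sum_congr rfl fun t _ => by ring
  have hdiam : (Lam ^ 2 - ((stateAt vmax ρ T v p (T + 1)).lam - l) ^ 2) *
      (vmax * Real.sqrt T / 2) ≤ Lam ^ 2 * vmax * Q := by
    calc _ ≤ Lam ^ 2 * (vmax * (2 * Q) / 2) := by
          apply mul_le_mul _ _ (by positivity) (by positivity)
          · linarith [sq_nonneg ((stateAt vmax ρ T v p (T + 1)).lam - l)]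
          · gcongr
      _ = _ := by ring
  rw [hogd'] at hogd
  rw [sum_Icc_one_eq (by omega)]
  rw [sum_Icc_one_eq (by omega), alive_one] at hcomp
  have hr1 : 0 ≤ act vmax ρ T v p 1 * rev (v 1) (p 1) := mul_nonneg (act_nonneg 1) (rev_nonneg _ _)
  set N := ∑ t ∈ Finset.Icc 2 T, alive vmax ρ T v p t with hN
  have hNT : 1 + N ≤ T := by
    have h1 : ∑ t ∈ Finset.Icc 1 T, alive vmax ρ T v p t ≤ ∑ _t ∈ Finset.Icc 1 T, (1 : ℝ) :=
      Finset.sum_le_sum fun t _ => alive_le_one t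
    rw [sum_Icc_one_eq (by omega), alive_one] at h1
    simpa using h1
  -- Every round that is not executed loses at most `vmax`; the comparator term repays exactly this
  -- amount.
  have hlost : (T : ℝ) * R ≤ N * R + vmax * (T - (1 + N)) + vmax := by
    have h1 := mul_nonneg (sub_nonneg.2 hR.2) (sub_nonneg.2 hNT)
    linarith only [h1, hR.2]
  have hratio : vmax / ρ * (2 * vmax + (3 * vmax * Q + vmax + 2 * κ * Q)) ≤
      Lam * ((3 * vmax + 3 * vmax + 2 * κ) * Q) := by
    have hVQ : vmax ≤ vmax * Q := le_mul_of_one_le_right hV.le hQ1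
    exact mul_le_mul hLam' (by linarith only [hVQ]) (by positivity) hLam0
  have hBL : (2 + Lam) * ∑ t ∈ Finset.Icc 2 T, β t ≤ (2 + Lam) * (2 * κ * Q) :=
    mul_le_mul_of_nonneg_left hB (by linarith)
  have hVQ : vmax ≤ vmax * Q := le_mul_of_one_le_right hV.le hQ1
  have hconst : regretConst vmax Lam κ * Q = 3 * (vmax * Q) + (2 * (3 * vmax * Q) +
      Lam * (3 * vmax * Q)) + Lam ^ 2 * vmax * Q + (4 * vmax + 3 * κ ^ 2 / vmax) * Q +
      (2 + Lam) * (2 * κ * Q) + Lam * ((3 * vmax + 3 * vmax + 2 * κ) * Q) := by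
    unfold regretConst; ring
  rw [hconst]
  linarith only [hsum, hrev', hpr', hpc', hcomp, hogd, hsq, hdiam, hlost, hratio, hBL, hVQ, hr1]

end RegretDeterministic

/-! ### Causality and measurability of the algorithm -/

lemma observed_subset_range {vmax ρ : ℝ} {T : ℕ} {v p : ℕ → ℝ} (t : ℕ) :
    (stateAt vmax ρ T v p t).observed ⊆ Finset.range t := by
  classical
  rcases Nat.eq_zero_or_pos t with rfl | ht
  · simp [stateAt, init]
  · rw [observed_eq ht]
    refine (Finset.filter_subset _ _).trans fun i hi => ?_
    simp only [Finset.mem_Ico, Finset.mem_range] at hi ⊢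
    exact hi.2

lemma estRev_congr {T : ℕ} {p p' : ℕ → ℝ} {I : Finset ℕ} (h : ∀ i ∈ I, p i = p' i) (w : ℝ) :
    estRev T p I w = estRev T p' I w := by
  unfold estRev
  rw [Finset.sum_congr rfl fun i hi => by rw [h i hi]]

lemma estCost_congr {T : ℕ} {p p' : ℕ → ℝ} {I : Finset ℕ} (h : ∀ i ∈ I, p i = p' i) (w : ℝ) :
    estCost T p I w = estCost T p' I w := by
  unfold estCost
  rw [Finset.sum_congr rfl fun i hi => by rw [h i hi]]

/-- Causality of the state: resampling the value or the bid of round `t` leaves `λ_t` and the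
running status unchanged, so they are predictable weights. -/
lemma stateAt_congr {vmax ρ : ℝ} {T : ℕ} {v p v' p' : ℕ → ℝ} {t : ℕ}
    (hv : ∀ s < t, v s = v' s) (hp : ∀ s < t, p s = p' s) :
    stateAt vmax ρ T v p t = stateAt vmax ρ T v' p' t := by
  induction t with
  | zero => rfl
  | succ t ih =>
    rcases Nat.eq_zero_or_pos t with rfl | ht
    · rfl
    have ih' := ih (fun s hs => hv s (by omega)) (fun s hs => hp s (by omega))
    have hI : ∀ i ∈ (stateAt vmax ρ T v' p' t).observed, p i = p' i := fun i hi =>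
      hp i (by have := Finset.mem_range.1 (observed_subset_range t hi); omega)
    rw [stateAt_succ ht, stateAt_succ ht, ih']
    have hE : Enters T p t (stateAt vmax ρ T v' p' t) (v t) =
        Enters T p' t (stateAt vmax ρ T v' p' t) (v' t) := by
      unfold Enters
      rw [estRev_congr hI, estCost_congr hI, hv t (by omega)]
    simp only [step]
    rw [hE, estCost_congr hI, hv t (by omega), hp t (by omega)]

/-- The current value may influence the decision but the current bid may not. This asymmetry gives
centred rewards of entered rounds mean zero when that bid is resampled. -/
lemma act_congr {vmax ρ : ℝ} {T : ℕ} {v p v' p' : ℕ → ℝ} {t : ℕ}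
    (hv : ∀ s ≤ t, v s = v' s) (hp : ∀ s < t, p s = p' s) :
    act vmax ρ T v p t = act vmax ρ T v' p' t := by
  have hs : stateAt vmax ρ T v p t = stateAt vmax ρ T v' p' t :=
    stateAt_congr (fun s hs => hv s hs.le) hp
  have hI : ∀ i ∈ (stateAt vmax ρ T v' p' t).observed, p i = p' i := fun i hi =>
    hp i (Finset.mem_range.1 (observed_subset_range t hi))
  have hE : Entered vmax ρ T v p t ↔ Entered vmax ρ T v' p' t := by
    unfold Entered Enters
    rw [hs, hv t le_rfl, estRev_congr hI, estCost_congr hI]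
  unfold act
  by_cases h : Entered vmax ρ T v p t
  · rw [if_pos h, if_pos (hE.1 h)]
  · rw [if_neg h, if_neg fun h' => h (hE.2 h')]

lemma alive_congr {vmax ρ : ℝ} {T : ℕ} {v p v' p' : ℕ → ℝ} {t : ℕ}
    (hv : ∀ s < t, v s = v' s) (hp : ∀ s < t, p s = p' s) :
    alive vmax ρ T v p t = alive vmax ρ T v' p' t := by
  unfold alive
  rw [stateAt_congr hv hp]

section Measurability

variable {Ω : Type*} [MeasurableSpace Ω]

lemma measurable_rev : Measurable fun z : ℝ × ℝ => rev z.1 z.2 := by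
  unfold rev; fun_prop

lemma measurable_cost : Measurable fun z : ℝ × ℝ => cost z.1 z.2 := by
  unfold cost
  exact Measurable.ite (measurableSet_le measurable_snd measurable_fst) measurable_snd
    measurable_const

/-- A state that is a measurable function of the outcome, with observations before round `n`. -/
structure MeasurableState (s : Ω → State) (n : ℕ) : Prop where
  lam : Measurable fun z => (s z).lam
  budget : Measurable fun z => (s z).budget
  running : MeasurableSet {z | (s z).running}
  observed : ∀ i, MeasurableSet {z | i ∈ (s z).observed}
  subset : ∀ z, (s z).observed ⊆ Finset.range n

lemma MeasurableState.sum {s : Ω → State} {n : ℕ} (h : MeasurableState s n) {f : Ω → ℕ → ℝ}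
    (hf : ∀ i, Measurable fun z => f z i) : Measurable fun z => ∑ i ∈ (s z).observed, f z i := by
  classical
  have : (fun z => ∑ i ∈ (s z).observed, f z i) =
      fun z => ∑ i ∈ Finset.range n, if i ∈ (s z).observed then f z i else 0 := by
    funext z
    rw [← Finset.sum_filter, Finset.filter_mem_eq_inter,
      Finset.inter_eq_right.2 (h.subset z)]
  rw [this]
  exact Finset.measurable_sum _ fun i _ => Measurable.ite (h.observed i) (hf i) measurable_const

lemma MeasurableState.card {s : Ω → State} {n : ℕ} (h : MeasurableState s n) :
    Measurable fun z => ((s z).observed.card : ℝ) := by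
  have := h.sum (f := fun _ _ => 1) fun _ => measurable_const
  simpa using this

lemma MeasurableState.radius {s : Ω → State} {n : ℕ} (h : MeasurableState s n) (T : ℕ) :
    Measurable fun z => radius T (s z).observed := by
  unfold OGDCB.radius
  have := h.card
  fun_prop

variable {v p : Ω → ℕ → ℝ}

lemma MeasurableState.estRev {s : Ω → State} {n : ℕ} (h : MeasurableState s n) (T : ℕ)
    (hv : ∀ t, Measurable fun z => v z t) (hp : ∀ t, Measurable fun z => p z t) (t : ℕ) :
    Measurable fun z => estRev T (p z) (s z).observed (v z t) := by
  unfold OGDCB.estRev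
  exact ((h.sum fun i => measurable_rev.comp ((hv t).prodMk (hp i))).div h.card).add
    ((h.radius T).mul (hv t))

lemma MeasurableState.estCost {s : Ω → State} {n : ℕ} (h : MeasurableState s n) (T : ℕ)
    (hv : ∀ t, Measurable fun z => v z t) (hp : ∀ t, Measurable fun z => p z t) (t : ℕ) :
    Measurable fun z => estCost T (p z) (s z).observed (v z t) := by
  unfold OGDCB.estCost
  exact ((h.sum fun i => measurable_cost.comp ((hv t).prodMk (hp i))).div h.card).sub
    (((h.radius T).const_mul 2).mul (hv t))

lemma MeasurableState.enters {s : Ω → State} {n : ℕ} (h : MeasurableState s n) (T : ℕ)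
    (hv : ∀ t, Measurable fun z => v z t) (hp : ∀ t, Measurable fun z => p z t) (t : ℕ) :
    MeasurableSet {z | Enters T (p z) t (s z) (v z t)} := by
  have h1 := measurableSet_le (h.lam.mul (h.estCost T hv hp t)) (h.estRev T hv hp t)
  exact h.running.inter ((MeasurableSet.const (t = 1)).union h1)

lemma MeasurableState.step {s : Ω → State} {n : ℕ} (h : MeasurableState s n) (vmax ρ : ℝ) (T : ℕ)
    (hv : ∀ t, Measurable fun z => v z t) (hp : ∀ t, Measurable fun z => p z t) {t : ℕ}
    (hn : n ≤ t) :
    MeasurableState (fun z => OGDCB.step vmax ρ T (v z) (p z) t (s z)) (t + 1) := by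
  classical
  have hE := h.enters T hv hp t
  have hx : Measurable fun z => if Enters T (p z) t (s z) (v z t) then (1 : ℝ) else 0 :=
    Measurable.ite hE measurable_const measurable_const
  have hb : Measurable fun z => (s z).budget -
      (if Enters T (p z) t (s z) (v z t) then (1 : ℝ) else 0) * cost (v z t) (p z t) :=
    h.budget.sub (hx.mul (measurable_cost.comp ((hv t).prodMk (hp t))))
  have hl : Measurable fun z => if t = 1 then (s z).lam else max ((s z).lam + stepSize vmax t *
      ((if Enters T (p z) t (s z) (v z t) then (1 : ℝ) else 0) *
        OGDCB.estCost T (p z) (s z).observed (v z t) - ρ)) 0 :=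
    Measurable.ite (MeasurableSet.const _) h.lam
      ((h.lam.add (((hx.mul (h.estCost T hv hp t)).sub_const ρ).const_mul _)).max measurable_const)
  refine ⟨?_, ?_, ?_, fun i => ?_, fun z => ?_⟩
  · convert Measurable.ite h.running hl h.lam using 1
    funext z
    exact apply_ite _ _ _ _
  · convert Measurable.ite h.running hb h.budget using 1
    funext z
    exact apply_ite _ _ _ _
  · have h1 := measurableSet_lt hb (measurable_const (a := vmax))
    convert h.running.inter h1.compl using 1
    ext z
    simp only [OGDCB.step, Set.mem_ofPred_eq, Set.mem_inter_iff, Set.mem_compl_iff]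
    split_ifs with hr <;> simp [hr]
  · have h1 : MeasurableSet {_z : Ω | i = t} := MeasurableSet.const (i = t)
    convert (h.observed i).union (hE.inter h1) using 1
    ext z
    simp only [OGDCB.step, Set.mem_ofPred_eq, Set.mem_inter_iff, Set.mem_union]
    by_cases hr : (s z).running
    · rw [if_pos hr]
      by_cases he : Enters T (p z) t (s z) (v z t)
      · simp [he, or_comm]
      · simp [he]
    · rw [if_neg hr]
      have he : ¬ Enters T (p z) t (s z) (v z t) := fun he => hr he.1
      simp [he]
  · have h1 := (h.subset z).trans (Finset.range_mono (hn.trans (Nat.le_succ t)))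
    simp only [OGDCB.step]
    by_cases hr : (s z).running
    · rw [if_pos hr]
      by_cases he : Enters T (p z) t (s z) (v z t)
      · simpa [he] using Finset.insert_subset (Finset.self_mem_range_succ t) h1
      · simpa [he] using h1
    · rw [if_neg hr]
      exact h1

lemma measurableState_stateAt (vmax ρ : ℝ) (T : ℕ)
    (hv : ∀ t, Measurable fun z => v z t) (hp : ∀ t, Measurable fun z => p z t) (t : ℕ) :
    MeasurableState (fun z => stateAt vmax ρ T (v z) (p z) t) t := by
  have h0 : ∀ n, MeasurableState (fun _ : Ω => init ρ T) n := fun n =>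
    ⟨measurable_const, measurable_const, MeasurableSet.const _, fun _ => MeasurableSet.const _,
      fun _ => by simp [init]⟩
  match t with
  | 0 => exact h0 0
  | 1 => exact h0 1
  | t + 2 => exact (measurableState_stateAt vmax ρ T hv hp (t + 1)).step vmax ρ T hv hp le_rfl

lemma measurable_act (vmax ρ : ℝ) (T : ℕ)
    (hv : ∀ t, Measurable fun z => v z t) (hp : ∀ t, Measurable fun z => p z t) (t : ℕ) :
    Measurable fun z => act vmax ρ T (v z) (p z) t := by
  unfold act
  exact Measurable.ite ((measurableState_stateAt vmax ρ T hv hp t).enters T hv hp t)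
    measurable_const measurable_const

lemma measurable_alive (vmax ρ : ℝ) (T : ℕ)
    (hv : ∀ t, Measurable fun z => v z t) (hp : ∀ t, Measurable fun z => p z t) (t : ℕ) :
    Measurable fun z => alive vmax ρ T (v z) (p z) t := by
  unfold alive
  exact Measurable.ite (measurableState_stateAt vmax ρ T hv hp t).running
    measurable_const measurable_const

end Measurability

lemma measurable_entry {T : ℕ} (t : ℕ) : Measurable fun x : Fin T → ℝ => entry x t := by
  unfold entry
  split_ifs
  · exact measurable_pi_apply _
  · exact measurable_const

lemma revenue_eq (vmax ρ : ℝ) {T : ℕ} (v p : Fin T → ℝ) :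
    revenue vmax ρ v p = ∑ t ∈ Finset.Icc 1 T,
      act vmax ρ T (entry v) (entry p) t * rev (entry v t) (entry p t) := by
  classical
  have hle : endTime vmax ρ T (entry v) (entry p) ≤ T :=
    Finset.sup_le fun t ht => (Finset.mem_Icc.1 (Finset.mem_filter.1 ht).1).2
  refine Finset.sum_subset (Finset.Icc_subset_Icc_right hle) fun t ht ht' => ?_
  rw [if_neg, zero_mul]
  intro hE
  apply ht'
  refine Finset.mem_Icc.2 ⟨(Finset.mem_Icc.1 ht).1, ?_⟩
  exact Finset.le_sup (f := id) (Finset.mem_filter.2 ⟨ht, hE⟩)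

lemma measurable_revenue (vmax ρ : ℝ) (T : ℕ) :
    Measurable fun z : (Fin T → ℝ) × (Fin T → ℝ) => revenue vmax ρ z.1 z.2 := by
  simp only [revenue_eq]
  have hv : ∀ t, Measurable fun z : (Fin T → ℝ) × (Fin T → ℝ) => entry z.1 t := fun t =>
    (measurable_entry t).comp measurable_fst
  have hp : ∀ t, Measurable fun z : (Fin T → ℝ) × (Fin T → ℝ) => entry z.2 t := fun t =>
    (measurable_entry t).comp measurable_snd
  exact Finset.measurable_sum _ fun t _ => (measurable_act vmax ρ T hv hp t).mul
    (measurable_rev.comp ((hv t).prodMk (hp t)))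

/-! ### The Azuma–Hoeffding inequality by resampling one coordinate at a time -/

section Azuma

open scoped ENNReal

variable {Ω : Type*} [MeasurableSpace Ω]

/-- Replacing part of the outcome `z` by a fresh sample `y` from `ν`, as in `U z y`, does not
change the law `μ`. -/
structure Resamples (μ : Measure Ω) (ν : Measure ℝ) (U : Ω → ℝ → Ω) : Prop where
  measurable : ∀ z, Measurable (U z)
  lintegral_eq : ∀ f : Ω → ℝ≥0∞, Measurable f → ∫⁻ z, f z ∂μ = ∫⁻ z, ∫⁻ y, f (U z y) ∂ν ∂μ

/-- Hoeffding's lemma on `[-b, b]`, whose half-length `b` gives the variance proxy `b²`. -/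
lemma lintegral_exp_mul_le {ν : Measure ℝ} [IsProbabilityMeasure ν] {X : ℝ → ℝ} {b : ℝ}
    (hb : 0 ≤ b) (hX : Measurable X) (hbound : ∀ᵐ y ∂ν, |X y| ≤ b) (hmean : ∫ y, X y ∂ν = 0)
    (s : ℝ) :
    ∫⁻ y, ENNReal.ofReal (Real.exp (s * X y)) ∂ν ≤
      ENNReal.ofReal (Real.exp (b ^ 2 * s ^ 2 / 2)) := by
  have hsub := ProbabilityTheory.hasSubgaussianMGF_of_mem_Icc_of_integral_eq_zero
    (a := -b) (b := b) hX.aemeasurable (hbound.mono fun y hy => abs_le.1 hy) hmean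
  rw [← ofReal_integral_eq_lintegral_ofReal (hsub.integrable_exp_mul s)
    (ae_of_all _ fun y => (Real.exp_pos _).le)]
  refine ENNReal.ofReal_le_ofReal ((hsub.mgf_le s).trans_eq ?_)
  congr 2
  push_cast
  rw [Real.norm_of_nonneg (by linarith)]
  ring

variable {μ : Measure Ω} {ν : Measure ℝ} {Good : Set Ω} {n : ℕ} {U : ℕ → Ω → ℝ → Ω}
  {D : ℕ → Ω → ℝ} {b : ℝ}

/-- Resampling plays the role of conditional expectation: `U t` preserves the law and all earlier
differences, while the fresh sample averages `D t` to zero. No filtration is needed, and `D t` may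
depend on coordinates of later rounds that `U t` leaves alone. -/
lemma lintegral_exp_sum_le [IsProbabilityMeasure μ] [IsProbabilityMeasure ν]
    (hGood : ∀ᵐ z ∂μ, z ∈ Good)
    (hU : ∀ t ∈ Finset.Icc 1 n, Resamples μ ν (U t))
    (hUG : ∀ t ∈ Finset.Icc 1 n, ∀ z ∈ Good, ∀ᵐ y ∂ν, U t z y ∈ Good)
    (hD : ∀ t, Measurable (D t))
    (hpast : ∀ t ∈ Finset.Icc 1 n, ∀ s < t, ∀ z y, D s (U t z y) = D s z)
    (hb : 0 ≤ b) (hbound : ∀ t ∈ Finset.Icc 1 n, ∀ z ∈ Good, |D t z| ≤ b)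
    (hmean : ∀ t ∈ Finset.Icc 1 n, ∀ z ∈ Good, ∫ y, D t (U t z y) ∂ν = 0) (s : ℝ) :
    ∀ m ≤ n, ∫⁻ z, ENNReal.ofReal (Real.exp (s * ∑ t ∈ Finset.Icc 1 m, D t z)) ∂μ ≤
      ENNReal.ofReal (Real.exp (m * (b ^ 2 * s ^ 2 / 2))) := by
  intro m
  induction m with
  | zero => intro _; simp
  | succ m ih =>
    intro hm
    have hmem : m + 1 ∈ Finset.Icc 1 n := Finset.mem_Icc.2 ⟨by omega, hm⟩
    have hS : ∀ k, Measurable fun z => ENNReal.ofReal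
        (Real.exp (s * ∑ t ∈ Finset.Icc 1 k, D t z)) := fun k => by
      have := Finset.measurable_sum (Finset.Icc 1 k) fun t _ => hD t
      fun_prop
    rw [(hU _ hmem).lintegral_eq _ (hS _)]
    have hstep : ∀ᵐ z ∂μ, ∫⁻ y, ENNReal.ofReal
        (Real.exp (s * ∑ t ∈ Finset.Icc 1 (m + 1), D t (U (m + 1) z y))) ∂ν ≤
        ENNReal.ofReal (Real.exp (s * ∑ t ∈ Finset.Icc 1 m, D t z)) *
          ENNReal.ofReal (Real.exp (b ^ 2 * s ^ 2 / 2)) := by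
      filter_upwards [hGood] with z hz
      have hDU : Measurable fun y => D (m + 1) (U (m + 1) z y) :=
        (hD _).comp ((hU _ hmem).measurable z)
      have heq : ∀ y, ENNReal.ofReal
          (Real.exp (s * ∑ t ∈ Finset.Icc 1 (m + 1), D t (U (m + 1) z y))) =
          ENNReal.ofReal (Real.exp (s * ∑ t ∈ Finset.Icc 1 m, D t z)) *
          ENNReal.ofReal (Real.exp (s * D (m + 1) (U (m + 1) z y))) := fun y => by
        rw [Finset.sum_Icc_succ_top (by omega), mul_add, Real.exp_add,
          ENNReal.ofReal_mul (Real.exp_pos _).le,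
          Finset.sum_congr rfl fun t ht => hpast _ hmem t
            (by have := (Finset.mem_Icc.1 ht).2; omega) z y]
      simp_rw [heq]
      rw [lintegral_const_mul _ (hDU.const_mul s).exp.ennreal_ofReal]
      exact mul_le_mul_right (lintegral_exp_mul_le hb hDU
        ((hUG _ hmem z hz).mono fun y hy => hbound _ hmem _ hy) (hmean _ hmem z hz) s) _
    refine (lintegral_mono_ae hstep).trans ?_
    rw [lintegral_mul_const _ (hS m)]
    refine (mul_le_mul_left (ih (by omega)) _).trans_eq ?_
    rw [← ENNReal.ofReal_mul (Real.exp_pos _).le, ← Real.exp_add]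
    congr 2
    push_cast
    ring

/-- **Azuma–Hoeffding**: a sum of `n` bounded martingale differences exceeds
`3 b √(n ln T)` with probability at most `T⁻³`. -/
lemma measureReal_sum_ge_le [IsProbabilityMeasure μ] [IsProbabilityMeasure ν]
    (hGood : ∀ᵐ z ∂μ, z ∈ Good)
    (hU : ∀ t ∈ Finset.Icc 1 n, Resamples μ ν (U t))
    (hUG : ∀ t ∈ Finset.Icc 1 n, ∀ z ∈ Good, ∀ᵐ y ∂ν, U t z y ∈ Good)
    (hD : ∀ t, Measurable (D t))
    (hpast : ∀ t ∈ Finset.Icc 1 n, ∀ s < t, ∀ z y, D s (U t z y) = D s z)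
    (hb : 0 < b) (hbound : ∀ t ∈ Finset.Icc 1 n, ∀ z ∈ Good, |D t z| ≤ b)
    (hmean : ∀ t ∈ Finset.Icc 1 n, ∀ z ∈ Good, ∫ y, D t (U t z y) ∂ν = 0)
    (hn : 1 ≤ n) {T : ℕ} (hT : 1 ≤ T) :
    μ.real {z | 3 * b * Real.sqrt (n * Real.log T) < ∑ t ∈ Finset.Icc 1 n, D t z} ≤
      1 / (T : ℝ) ^ 3 := by
  have hT0 : (0 : ℝ) < T := by exact_mod_cast hT
  have hn0 : (0 : ℝ) < n := by exact_mod_cast hn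
  have hL : 0 ≤ Real.log T := Real.log_natCast_nonneg T
  set x := 3 * b * Real.sqrt (n * Real.log T)
  have hx2 : x ^ 2 = 9 * b ^ 2 * (n * Real.log T) := by
    simp only [x]
    rw [mul_pow, Real.sq_sqrt (by positivity)]
    ring
  have hx0 : 0 ≤ x := by positivity
  -- The minimizer of the Chernoff exponent `n b² s² / 2 - s x`. Its value is `-(9/2) ln T`, which
  -- leaves room below the required `-3 ln T`.
  set s := x / (n * b ^ 2)
  have hs0 : 0 ≤ s := by positivity
  have hmgf := lintegral_exp_sum_le hGood hU hUG hD hpast hb.le hbound hmean s n le_rfl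
  have hS : Measurable fun z => ENNReal.ofReal
      (Real.exp (s * ∑ t ∈ Finset.Icc 1 n, D t z)) := by
    have := Finset.measurable_sum (Finset.Icc 1 n) fun t _ => hD t
    fun_prop
  have hmarkov := meas_ge_le_lintegral_div (μ := μ) hS.aemeasurable
    (ε := ENNReal.ofReal (Real.exp (s * x))) (by simpa using Real.exp_pos _) ENNReal.ofReal_ne_top
  have hle : μ {z | x < ∑ t ∈ Finset.Icc 1 n, D t z} ≤ ENNReal.ofReal (1 / (T : ℝ) ^ 3) := by
    refine (measure_mono fun z hz => ?_).trans (hmarkov.trans ?_)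
    · exact ENNReal.ofReal_le_ofReal (Real.exp_le_exp.2
        (mul_le_mul_of_nonneg_left (le_of_lt hz) hs0))
    · refine (ENNReal.div_le_div_right hmgf _).trans ?_
      rw [← ENNReal.ofReal_div_of_pos (Real.exp_pos _), ← Real.exp_sub]
      refine ENNReal.ofReal_le_ofReal ?_
      have h1 : (n : ℝ) * (b ^ 2 * s ^ 2 / 2) - s * x = -(9 / 2 * Real.log T) := by
        have h2 : (n : ℝ) * (b ^ 2 * s ^ 2 / 2) - s * x = -(x ^ 2 / (2 * (n * b ^ 2))) := by
          simp only [s]; field_simp; ring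
        rw [h2, hx2]
        field_simp
      have h3 : 1 / (T : ℝ) ^ 3 = Real.exp (-(3 * Real.log T)) := by
        rw [Real.exp_neg, one_div, show (3 : ℝ) * Real.log T = ((3 : ℕ) : ℝ) * Real.log T by
          norm_num, Real.exp_nat_mul, Real.exp_log hT0]
      rw [h1, h3]
      exact Real.exp_le_exp.2 (by linarith)
  exact ENNReal.toReal_le_of_le_ofReal (by positivity) hle

end Azuma

/-! ### Resampling one value or one competing bid -/

section Input

open scoped ENNReal

variable {T : ℕ}

/-- Replace the `t`-th entry of a vector by `y`. -/
def setEntry (x : Fin T → ℝ) (t : ℕ) (y : ℝ) : Fin T → ℝ :=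
  fun i => if i.val + 1 = t then y else x i

/-- Replace the value of round `t` by `y`. -/
def setValue (t : ℕ) (z : (Fin T → ℝ) × (Fin T → ℝ)) (y : ℝ) : (Fin T → ℝ) × (Fin T → ℝ) :=
  (setEntry z.1 t y, z.2)

/-- Replace the competing bid of round `t` by `y`. -/
def setBid (t : ℕ) (z : (Fin T → ℝ) × (Fin T → ℝ)) (y : ℝ) : (Fin T → ℝ) × (Fin T → ℝ) :=
  (z.1, setEntry z.2 t y)

lemma entry_setEntry_self {t : ℕ} (ht : t ∈ Finset.Icc 1 T) (x : Fin T → ℝ) (y : ℝ) :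
    entry (setEntry x t y) t = y := by
  have h := Finset.mem_Icc.1 ht
  rw [entry, dif_pos h, setEntry, if_pos (by simp; omega)]

lemma entry_setEntry_of_ne {s t : ℕ} (hst : s ≠ t) (x : Fin T → ℝ) (y : ℝ) :
    entry (setEntry x t y) s = entry x s := by
  unfold entry setEntry
  split_ifs with h h'
  · simp at h'; omega
  · rfl
  · rfl

lemma setEntry_eq_update {t : ℕ} (ht : t ∈ Finset.Icc 1 T) (x : Fin T → ℝ) (y : ℝ) :
    setEntry x t y = Function.update x
      ⟨t - 1, by have := Finset.mem_Icc.1 ht; omega⟩ y := by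
  have h := Finset.mem_Icc.1 ht
  funext i
  unfold setEntry
  by_cases hi : i.val + 1 = t
  · have : i = ⟨t - 1, by omega⟩ := Fin.ext (by simp; omega)
    rw [if_pos hi, this, Function.update_self]
  · rw [if_neg hi, Function.update_of_ne (fun h' => hi (by rw [h']; simp; omega))]

/-- The inner integral is the marginal over one coordinate. It no longer depends on that coordinate,
so integrating it out again changes nothing. -/
lemma lintegral_pi_setEntry {ν : Measure ℝ} [IsProbabilityMeasure ν] {t : ℕ}
    (ht : t ∈ Finset.Icc 1 T) {f : (Fin T → ℝ) → ℝ≥0∞} (hf : Measurable f) :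
    ∫⁻ x, f x ∂(Measure.pi fun _ : Fin T => ν) =
      ∫⁻ x, ∫⁻ y, f (setEntry x t y) ∂ν ∂(Measure.pi fun _ : Fin T => ν) := by
  set i : Fin T := ⟨t - 1, by have := Finset.mem_Icc.1 ht; omega⟩
  have hmarg : (fun x => ∫⁻ y, f (setEntry x t y) ∂ν) =
      lmarginal (fun _ : Fin T => ν) {i} f := by
    rw [lmarginal_singleton]
    funext x
    simp only [setEntry_eq_update ht]
    rfl
  rw [show ∫⁻ x, ∫⁻ y, f (setEntry x t y) ∂ν ∂(Measure.pi fun _ : Fin T => ν) =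
    ∫⁻ x, lmarginal (fun _ : Fin T => ν) {i} f x ∂(Measure.pi fun _ : Fin T => ν) by rw [← hmarg]]
  refine lintegral_eq_of_lmarginal_eq {i} hf (hf.lmarginal _) ?_
  funext x
  conv_rhs => rw [lmarginal_singleton]
  have : ∀ y, lmarginal (fun _ : Fin T => ν) {i} f (Function.update x i y) =
      lmarginal (fun _ : Fin T => ν) {i} f x := fun y =>
    lmarginal_update_of_mem _ (Finset.mem_singleton_self i) f x y
  simp [this]

lemma measurable_setEntry (t : ℕ) : Measurable fun q : (Fin T → ℝ) × ℝ => setEntry q.1 t q.2 := by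
  unfold setEntry
  refine measurable_pi_lambda _ fun i => ?_
  split_ifs
  · exact measurable_snd
  · exact (measurable_pi_apply i).comp measurable_fst

variable {F G : Measure ℝ} [IsProbabilityMeasure G]

instance [IsProbabilityMeasure F] : IsProbabilityMeasure (inputLaw T F G) := by
  unfold inputLaw; infer_instance

lemma resamples_setBid [SFinite F] {t : ℕ} (ht : t ∈ Finset.Icc 1 T) :
    Resamples (inputLaw T F G) G (setBid t) where
  measurable z := measurable_const.prodMk
    ((measurable_setEntry t).comp (measurable_const.prodMk measurable_id))
  lintegral_eq f hf := by
    have hm : Measurable fun q : ((Fin T → ℝ) × (Fin T → ℝ)) × ℝ => f (setBid t q.1 q.2) :=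
      hf.comp ((measurable_fst.comp measurable_fst).prodMk ((measurable_setEntry t).comp
        ((measurable_snd.comp measurable_fst).prodMk measurable_snd)))
    unfold inputLaw
    rw [lintegral_prod _ hf.aemeasurable, lintegral_prod _ hm.lintegral_prod_right'.aemeasurable]
    refine lintegral_congr fun v => ?_
    exact lintegral_pi_setEntry ht (hf.comp measurable_prodMk_left)

variable [IsProbabilityMeasure F]

lemma resamples_setValue {t : ℕ} (ht : t ∈ Finset.Icc 1 T) :
    Resamples (inputLaw T F G) F (setValue t) where
  measurable z := ((measurable_setEntry t).comp
    (measurable_const.prodMk measurable_id)).prodMk measurable_const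
  lintegral_eq f hf := by
    have hm : Measurable fun q : ((Fin T → ℝ) × (Fin T → ℝ)) × ℝ => f (setValue t q.1 q.2) :=
      hf.comp (((measurable_setEntry t).comp
        ((measurable_fst.comp measurable_fst).prodMk measurable_snd)).prodMk
          (measurable_snd.comp measurable_fst))
    unfold inputLaw
    rw [lintegral_prod_symm _ hf.aemeasurable,
      lintegral_prod_symm _ hm.lintegral_prod_right'.aemeasurable]
    refine lintegral_congr fun p => ?_
    exact lintegral_pi_setEntry ht (hf.comp measurable_prodMk_right)

/-- The inputs all of whose values and bids lie in `[0, vmax]`. -/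
def boundedInputs (T : ℕ) (vmax : ℝ) : Set ((Fin T → ℝ) × (Fin T → ℝ)) :=
  {z | (∀ i, z.1 i ∈ Set.Icc 0 vmax) ∧ ∀ i, z.2 i ∈ Set.Icc 0 vmax}

variable {vmax : ℝ}

lemma ae_mem_Icc (hF : F (Set.Icc 0 vmax) = 1) : ∀ᵐ y ∂F, y ∈ Set.Icc 0 vmax :=
  (prob_compl_eq_zero_iff measurableSet_Icc).2 hF

lemma ae_mem_boundedInputs (hF : F (Set.Icc 0 vmax) = 1) (hG : G (Set.Icc 0 vmax) = 1) :
    ∀ᵐ z ∂inputLaw T F G, z ∈ boundedInputs T vmax := by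
  have h1 : ∀ (ν : Measure ℝ) [IsProbabilityMeasure ν], ν (Set.Icc 0 vmax) = 1 →
      ∀ᵐ x ∂(Measure.pi fun _ : Fin T => ν), ∀ i, x i ∈ Set.Icc 0 vmax := fun ν _ hν =>
    ae_all_iff.2 fun i => Measure.tendsto_eval_ae_ae.eventually (ae_mem_Icc hν)
  have h2 := Measure.quasiMeasurePreserving_fst (μ := Measure.pi fun _ : Fin T => F)
    (ν := Measure.pi fun _ : Fin T => G) |>.ae (h1 F hF)
  have h3 := Measure.quasiMeasurePreserving_snd (μ := Measure.pi fun _ : Fin T => F)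
    (ν := Measure.pi fun _ : Fin T => G) |>.ae (h1 G hG)
  filter_upwards [h2, h3] with z hz1 hz2 using ⟨hz1, hz2⟩

/-- The default entry `0` also lies in `[0, vmax]`, so the deterministic lemmas may assume bounds at
every index. -/
lemma entry_mem_Icc (hV : 0 ≤ vmax) {x : Fin T → ℝ} (hx : ∀ i, x i ∈ Set.Icc 0 vmax) (t : ℕ) :
    entry x t ∈ Set.Icc 0 vmax := by
  unfold entry
  split_ifs
  · exact hx _
  · exact ⟨le_rfl, hV⟩

lemma setEntry_mem_Icc {x : Fin T → ℝ} (hx : ∀ i, x i ∈ Set.Icc 0 vmax) (t : ℕ) {y : ℝ}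
    (hy : y ∈ Set.Icc 0 vmax) (i : Fin T) : setEntry x t y i ∈ Set.Icc 0 vmax := by
  unfold setEntry
  split_ifs
  · exact hy
  · exact hx i

lemma setBid_mem (hG : G (Set.Icc 0 vmax) = 1) {z : (Fin T → ℝ) × (Fin T → ℝ)}
    (hz : z ∈ boundedInputs T vmax) (t : ℕ) : ∀ᵐ y ∂G, setBid t z y ∈ boundedInputs T vmax := by
  filter_upwards [ae_mem_Icc hG] with y hy using ⟨hz.1, setEntry_mem_Icc hz.2 t hy⟩

lemma setValue_mem (hF : F (Set.Icc 0 vmax) = 1) {z : (Fin T → ℝ) × (Fin T → ℝ)}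
    (hz : z ∈ boundedInputs T vmax) (t : ℕ) : ∀ᵐ y ∂F, setValue t z y ∈ boundedInputs T vmax := by
  filter_upwards [ae_mem_Icc hF] with y hy using ⟨setEntry_mem_Icc hz.1 t hy, hz.2⟩

end Input

/-! ### Concentration of the algorithm's estimates -/

/-- The mean over the competing bid of a reward `f`, as a function of the value. -/
noncomputable def bidMean (f : ℝ → ℝ → ℝ) (G : Measure ℝ) (w : ℝ) : ℝ := ∫ y, f w y ∂G

section Concentration

variable {vmax ρ : ℝ} {T : ℕ} {F G : Measure ℝ} [IsProbabilityMeasure G]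

/-- A measurable function of value and bid that takes values in `[0, vmax]` on `[0, vmax]²`. -/
structure BoundedReward (vmax : ℝ) (f : ℝ → ℝ → ℝ) : Prop where
  measurable : Measurable fun z : ℝ × ℝ => f z.1 z.2
  mem : ∀ w ∈ Set.Icc 0 vmax, ∀ y ∈ Set.Icc 0 vmax, f w y ∈ Set.Icc 0 vmax

lemma boundedReward_rev (vmax : ℝ) : BoundedReward vmax rev :=
  ⟨measurable_rev, fun _ hw _ hy => ⟨rev_nonneg _ _, (rev_le hw.1 hy.1).trans hw.2⟩⟩

lemma boundedReward_cost (vmax : ℝ) : BoundedReward vmax cost :=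
  ⟨measurable_cost, fun _ hw _ hy => ⟨cost_nonneg hy.1, (cost_le hw.1).trans hw.2⟩⟩

lemma integral_mem_Icc {ν : Measure ℝ} [IsProbabilityMeasure ν] {g : ℝ → ℝ} (hg : Measurable g)
    (h : ∀ᵐ y ∂ν, g y ∈ Set.Icc 0 vmax) :
    Integrable g ν ∧ ∫ y, g y ∂ν ∈ Set.Icc 0 vmax := by
  have hint : Integrable g ν := Integrable.of_mem_Icc 0 vmax hg.aemeasurable h
  refine ⟨hint, integral_nonneg_of_ae (h.mono fun y hy => hy.1), ?_⟩
  calc ∫ y, g y ∂ν ≤ ∫ _y, vmax ∂ν :=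
        integral_mono_ae hint (integrable_const _) (h.mono fun y hy => hy.2)
    _ = vmax := by simp

variable {f : ℝ → ℝ → ℝ}

lemma BoundedReward.section_mem (hf : BoundedReward vmax f) (hG : G (Set.Icc 0 vmax) = 1) {w : ℝ}
    (hw : w ∈ Set.Icc 0 vmax) :
    Integrable (f w) G ∧ bidMean f G w ∈ Set.Icc 0 vmax :=
  integral_mem_Icc (hf.measurable.comp measurable_prodMk_left)
    ((ae_mem_Icc hG).mono fun y hy => hf.mem w hw y hy)

lemma BoundedReward.measurable_bidMean (hf : BoundedReward vmax f) :
    Measurable (bidMean f G) :=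
  (hf.measurable.stronglyMeasurable.integral_prod_right (ν := G)).measurable

lemma abs_sub_le_of_mem_Icc {a b c : ℝ} (ha : a ∈ Set.Icc 0 c) (hb : b ∈ Set.Icc 0 c) :
    |a - b| ≤ c := abs_le.2 ⟨by linarith [ha.1, hb.2], by linarith [ha.2, hb.1]⟩

lemma measurable_value (t : ℕ) :
    Measurable fun z : (Fin T → ℝ) × (Fin T → ℝ) => entry z.1 t :=
  (measurable_entry t).comp measurable_fst

lemma measurable_bid (t : ℕ) :
    Measurable fun z : (Fin T → ℝ) × (Fin T → ℝ) => entry z.2 t :=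
  (measurable_entry t).comp measurable_snd

variable [IsProbabilityMeasure F]

/-- The rewards of the entered rounds concentrate around their means over the bids; the reward of
round `τ` may be evaluated at the value of any round `j τ`. -/
lemma bid_deviation (hV : 0 < vmax) (hF : F (Set.Icc 0 vmax) = 1) (hG : G (Set.Icc 0 vmax) = 1)
    (hf : BoundedReward vmax f) {σ : ℝ} (hσ : |σ| = 1) (j : ℕ → ℕ) {n : ℕ} (hn : 1 ≤ n)
    (hnT : n ≤ T) :
    (inputLaw T F G).real {z | 3 * vmax * Real.sqrt (n * Real.log T) < ∑ t ∈ Finset.Icc 1 n,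
      σ * (act vmax ρ T (entry z.1) (entry z.2) t *
        (f (entry z.1 (j t)) (entry z.2 t) - bidMean f G (entry z.1 (j t))))} ≤
      1 / (T : ℝ) ^ 3 := by
  have hmem : ∀ t ∈ Finset.Icc 1 n, t ∈ Finset.Icc 1 T := fun t ht =>
    Finset.Icc_subset_Icc_right hnT ht
  have hact : ∀ {s t : ℕ}, s ≤ t → ∀ (z : (Fin T → ℝ) × (Fin T → ℝ)) (y : ℝ),
      act vmax ρ T (entry (setBid t z y).1) (entry (setBid t z y).2) s =
      act vmax ρ T (entry z.1) (entry z.2) s := fun {s t} hst z y =>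
    act_congr (fun _ _ => rfl) fun i hi => entry_setEntry_of_ne (by omega) _ _
  -- Only bids are resampled, so all values act as fixed parameters. This allows past rewards to be
  -- evaluated at the value of a later round `j t`, as the estimates require.
  refine measureReal_sum_ge_le (ν := G) (U := setBid)
    (D := fun t z => σ * (act vmax ρ T (entry z.1) (entry z.2) t *
        (f (entry z.1 (j t)) (entry z.2 t) - bidMean f G (entry z.1 (j t)))))
    (ae_mem_boundedInputs hF hG)
    (fun t ht => resamples_setBid (hmem t ht)) (fun t _ z hz => setBid_mem hG hz t)
    (fun t => ?_) (fun t _ s hs z y => ?_) hV (fun t _ z hz => ?_) (fun t ht z hz => ?_)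
    hn (hn.trans hnT)
  · exact ((measurable_act vmax ρ T measurable_value measurable_bid t).mul
      ((hf.measurable.comp ((measurable_value _).prodMk (measurable_bid t))).sub
        (hf.measurable_bidMean.comp (measurable_value _)))).const_mul σ
  · rw [hact hs.le, show entry (setBid t z y).2 s = entry z.2 s from
      entry_setEntry_of_ne hs.ne _ _]
    rfl
  · rw [abs_mul, hσ, one_mul, abs_mul, abs_of_nonneg (act_nonneg t)]
    have hv := entry_mem_Icc hV.le hz.1 (j t)
    have h1 := abs_sub_le_of_mem_Icc (hf.mem _ hv _ (entry_mem_Icc hV.le hz.2 t))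
      (hf.section_mem hG hv).2
    exact (mul_le_of_le_one_left (abs_nonneg _) (act_le_one t)).trans h1
  · simp only [hact le_rfl]
    have hv := entry_mem_Icc hV.le hz.1 (j t)
    have h1 : ∀ y, entry (setBid t z y).2 t = y := fun y => entry_setEntry_self (hmem t ht) _ y
    have h2 : ∀ y, entry (setBid t z y).1 (j t) = entry z.1 (j t) := fun y => rfl
    simp only [h1, h2]
    rw [integral_const_mul, integral_const_mul,
      integral_sub (hf.section_mem hG hv).1 (integrable_const _)]
    simp [bidMean]

/-- Predictably weighted sums of a function of the current value concentrate. -/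
lemma value_deviation (hV : 0 < vmax) (hF : F (Set.Icc 0 vmax) = 1) (hG : G (Set.Icc 0 vmax) = 1)
    {h : ℝ → ℝ} (hh : Measurable h) (hmem : ∀ w ∈ Set.Icc 0 vmax, h w ∈ Set.Icc 0 vmax)
    {W : ℕ → (Fin T → ℝ) × (Fin T → ℝ) → ℝ} (hW : ∀ t, Measurable (W t)) {B : ℝ} (hB : 0 < B)
    (hWB : ∀ t, ∀ z ∈ boundedInputs T vmax, |W t z| ≤ B)
    (hpred : ∀ s t, s ≤ t → ∀ z y, W s (setValue t z y) = W s z) (hT : 1 ≤ T) :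
    (inputLaw T F G).real {z | 3 * (B * vmax) * Real.sqrt (T * Real.log T) <
      ∑ t ∈ Finset.Icc 1 T, W t z * (∫ w, h w ∂F - h (entry z.1 t))} ≤ 1 / (T : ℝ) ^ 3 := by
  have hmean := integral_mem_Icc (ν := F) hh ((ae_mem_Icc hF).mono hmem)
  refine measureReal_sum_ge_le (ν := F) (U := setValue)
    (D := fun t z => W t z * (∫ w, h w ∂F - h (entry z.1 t)))
    (ae_mem_boundedInputs hF hG)
    (fun t ht => resamples_setValue ht) (fun t _ z hz => setValue_mem hF hz t)
    (fun t => ?_) (fun t _ s hs z y => ?_) (mul_pos hB hV) (fun t _ z hz => ?_)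
    (fun t ht z hz => ?_) hT hT
  · exact (hW t).mul ((hh.comp (measurable_value t)).const_sub _)
  · rw [hpred s t hs.le, show entry (setValue t z y).1 s = entry z.1 s from
      entry_setEntry_of_ne hs.ne _ _]
  · rw [abs_mul]
    exact mul_le_mul (hWB t z hz) (abs_sub_le_of_mem_Icc hmean.2
      (hmem _ (entry_mem_Icc hV.le hz.1 t))) (abs_nonneg _) hB.le
  · simp only [hpred t t le_rfl]
    have h1 : ∀ y, entry (setValue t z y).1 t = y := fun y => entry_setEntry_self ht _ y
    simp only [h1]
    rw [integral_const_mul, integral_sub (integrable_const _) hmean.1]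
    simp

end Concentration

/-! ### From deviations over entered rounds to errors of the estimates. -/

section Estimates

variable {vmax ρ : ℝ} {T : ℕ} {v p : ℕ → ℝ}

lemma freqConst_pos (hρ : 0 < ρ) (hV : 0 < vmax) : 0 < freqConst vmax ρ :=
  lt_min (by positivity) (by positivity)

lemma freqConst_le_one (hρ : 0 < ρ) (hρv : ρ ≤ vmax) : freqConst vmax ρ ≤ 1 := by
  have hV : 0 < vmax := hρ.trans_le hρv
  have h1 : ρ / vmax ≤ 1 := (div_le_one hV).2 hρv
  have h2 : (ρ / vmax) ^ 2 ≤ 1 := pow_le_one₀ (by positivity) h1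
  exact (min_le_left _ _).trans (by linarith)

/-- The factor `1/2` trades `t - 1` for `t`, using `t ≥ 2`. -/
lemma half_freqConst_mul_le (hρ : 0 < ρ) (hρv : ρ ≤ vmax) (hv : ∀ t, v t ∈ Set.Icc 0 vmax)
    {t : ℕ} (ht : 2 ≤ t) (hr : (stateAt vmax ρ T v p t).running) :
    freqConst vmax ρ * t / 2 ≤ ((stateAt vmax ρ T v p t).observed.card : ℝ) := by
  have h := freqConst_mul_le_card_observed hv hρ hρv t ht
    (running_of_le (by omega) (Nat.sub_le t 1) hr)
  have h1 : (2 : ℝ) ≤ t := by exact_mod_cast ht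
  have h2 := freqConst_pos hρ (hρ.trans_le hρv)
  nlinarith

lemma radius_le (hρ : 0 < ρ) (hρv : ρ ≤ vmax) (hv : ∀ t, v t ∈ Set.Icc 0 vmax) (hT : 2 ≤ T)
    {t : ℕ} (ht : 2 ≤ t) (hr : (stateAt vmax ρ T v p t).running) :
    radius T (stateAt vmax ρ T v p t).observed ≤
      2 / freqConst vmax ρ * (Real.sqrt (Real.log T) * (1 / Real.sqrt t)) := by
  have hC := freqConst_pos hρ (hρ.trans_le hρv)
  have hC1 := freqConst_le_one hρ hρv
  have hN := half_freqConst_mul_le hρ hρv hv ht hr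
  have hL := (sqrt_log_facts hT).2.2.2.2
  have hL0 : 0 ≤ Real.log T := Real.log_natCast_nonneg T
  have ht0 : (0 : ℝ) < t := by exact_mod_cast (by omega : 0 < t)
  set C := freqConst vmax ρ
  set N := ((stateAt vmax ρ T v p t).observed.card : ℝ)
  unfold radius
  refine Real.sqrt_le_iff.2 ⟨by positivity, ?_⟩
  rw [mul_pow, mul_pow, Real.sq_sqrt hL0, div_pow, div_pow, Real.sq_sqrt ht0.le]
  have hCt : 0 < C * t / 2 := by positivity
  calc (Real.log 2 + 2 * Real.log T) / (2 * N)
      ≤ (3 * Real.log T) / (2 * (C * t / 2)) := by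
        apply div_le_div₀ (by positivity) (by linarith) (by positivity) (by linarith)
    _ = 3 * Real.log T * C / (C ^ 2 * t) := by field_simp
    _ ≤ 4 * Real.log T * 1 / (C ^ 2 * t) := by
        gcongr; norm_num
    _ = _ := by ring

/-- An empirical mean over the observed rounds is close to the true mean when the corresponding
sum over the entered rounds is small. -/
lemma abs_avg_sub_le (hρ : 0 < ρ) (hρv : ρ ≤ vmax) (hv : ∀ t, v t ∈ Set.Icc 0 vmax)
    {t : ℕ} (ht : 2 ≤ t) (hr : (stateAt vmax ρ T v p t).running) {g : ℕ → ℝ} {m : ℝ}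
    (h : |∑ s ∈ Finset.Icc 1 (t - 1), act vmax ρ T v p s * (g s - m)| ≤
      3 * vmax * Real.sqrt ((t - 1 : ℕ) * Real.log T)) :
    |(∑ s ∈ (stateAt vmax ρ T v p t).observed, g s) /
      ((stateAt vmax ρ T v p t).observed.card : ℝ) - m| ≤
      6 * vmax / freqConst vmax ρ * (Real.sqrt (Real.log T) * (1 / Real.sqrt t)) := by
  have hV : 0 < vmax := hρ.trans_le hρv
  have hC := freqConst_pos hρ hV
  have hN := half_freqConst_mul_le hρ hρv hv ht hr
  have hN1 := one_le_card_observed (vmax := vmax) (ρ := ρ) (T := T) (v := v) (p := p) ht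
  have hL0 : 0 ≤ Real.log T := Real.log_natCast_nonneg T
  have ht0 : (0 : ℝ) < t := by exact_mod_cast (by omega : 0 < t)
  have hIco : Finset.Ico 1 t = Finset.Icc 1 (t - 1) := by
    ext i; simp only [Finset.mem_Ico, Finset.mem_Icc]; omega
  -- The number of observed rounds is itself the sum of the decisions, so the error of the
  -- random-size average is the martingale sum divided by that number.
  have heq : (∑ s ∈ (stateAt vmax ρ T v p t).observed, g s) /
      ((stateAt vmax ρ T v p t).observed.card : ℝ) - m =
      (∑ s ∈ Finset.Icc 1 (t - 1), act vmax ρ T v p s * (g s - m)) /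
        ((stateAt vmax ρ T v p t).observed.card : ℝ) := by
    rw [eq_div_iff (by linarith), sub_mul, div_mul_cancel₀ _ (by linarith),
      sum_observed_eq (by omega), card_observed_eq (by omega), hIco, Finset.mul_sum,
      ← Finset.sum_sub_distrib]
    exact Finset.sum_congr rfl fun s _ => by ring
  rw [heq, abs_div, abs_of_pos (by linarith : (0 : ℝ) <
    ((stateAt vmax ρ T v p t).observed.card : ℝ))]
  have hsqrt : Real.sqrt ((t - 1 : ℕ) * Real.log T) ≤ Real.sqrt t * Real.sqrt (Real.log T) := by
    rw [← Real.sqrt_mul ht0.le]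
    refine Real.sqrt_le_sqrt (mul_le_mul_of_nonneg_right ?_ hL0)
    exact_mod_cast Nat.sub_le t 1
  have hst : 0 < Real.sqrt t := Real.sqrt_pos.2 ht0
  have hst2 : Real.sqrt t ^ 2 = t := Real.sq_sqrt ht0.le
  calc _ ≤ (3 * vmax * (Real.sqrt t * Real.sqrt (Real.log T))) / (freqConst vmax ρ * t / 2) := by
        apply div_le_div₀ (by positivity) (h.trans (by gcongr)) (by positivity) hN
    _ = _ := by
        rw [← hst2, Real.sqrt_sq hst.le]
        field_simp
        ring

/-- The constant in front of the confidence radius. -/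
noncomputable def estimateConst (vmax ρ : ℝ) : ℝ := 12 * vmax / freqConst vmax ρ

lemma estRev_close (hρ : 0 < ρ) (hρv : ρ ≤ vmax) (hv : ∀ t, v t ∈ Set.Icc 0 vmax) (hT : 2 ≤ T)
    {t : ℕ} (ht : 2 ≤ t) (hr : (stateAt vmax ρ T v p t).running) {m : ℝ}
    (h : |∑ s ∈ Finset.Icc 1 (t - 1), act vmax ρ T v p s * (rev (v t) (p s) - m)| ≤
      3 * vmax * Real.sqrt ((t - 1 : ℕ) * Real.log T)) :
    |estRev T p (stateAt vmax ρ T v p t).observed (v t) - m| ≤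
      estimateConst vmax ρ * Real.sqrt (Real.log T) * (1 / Real.sqrt t) := by
  have h1 := abs_le.1 (abs_avg_sub_le hρ hρv hv ht hr h)
  have h2 := radius_le hρ hρv hv hT ht hr
  have h3 := radius_nonneg T (stateAt vmax ρ T v p t).observed
  have hV : 0 < vmax := hρ.trans_le hρv
  have hC := freqConst_pos hρ hV
  set q := Real.sqrt (Real.log T) * (1 / Real.sqrt t) with hq
  have hq0 : 0 ≤ q := by positivity
  have h4 : radius T (stateAt vmax ρ T v p t).observed * v t ≤ 2 / freqConst vmax ρ * q * vmax :=
    mul_le_mul h2 (hv t).2 (hv t).1 (by positivity)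
  have h5 := mul_nonneg h3 (hv t).1
  have h6 : 0 ≤ vmax / freqConst vmax ρ * q := by positivity
  have e1 : 2 / freqConst vmax ρ * q * vmax = 2 * (vmax / freqConst vmax ρ * q) := by ring
  have e2 : 6 * vmax / freqConst vmax ρ * q = 6 * (vmax / freqConst vmax ρ * q) := by ring
  -- In units of `vmax / freqConst` times `√(ln T / t)`, sampling contributes `6` and the confidence
  -- term `2` here, or `4` for costs; `12` covers both cases.
  have e3 : estimateConst vmax ρ * Real.sqrt (Real.log T) * (1 / Real.sqrt t) =
    12 * (vmax / freqConst vmax ρ * q) := by rw [estimateConst, hq]; ring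
  rw [e1] at h4
  rw [e2] at h1
  rw [e3, abs_le]
  unfold estRev
  constructor <;> linarith

lemma estCost_close (hρ : 0 < ρ) (hρv : ρ ≤ vmax) (hv : ∀ t, v t ∈ Set.Icc 0 vmax) (hT : 2 ≤ T)
    {t : ℕ} (ht : 2 ≤ t) (hr : (stateAt vmax ρ T v p t).running) {m : ℝ}
    (h : |∑ s ∈ Finset.Icc 1 (t - 1), act vmax ρ T v p s * (cost (v t) (p s) - m)| ≤
      3 * vmax * Real.sqrt ((t - 1 : ℕ) * Real.log T)) :
    |estCost T p (stateAt vmax ρ T v p t).observed (v t) - m| ≤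
      estimateConst vmax ρ * Real.sqrt (Real.log T) * (1 / Real.sqrt t) := by
  have h1 := abs_le.1 (abs_avg_sub_le hρ hρv hv ht hr h)
  have h2 := radius_le hρ hρv hv hT ht hr
  have h3 := radius_nonneg T (stateAt vmax ρ T v p t).observed
  have hV : 0 < vmax := hρ.trans_le hρv
  have hC := freqConst_pos hρ hV
  set q := Real.sqrt (Real.log T) * (1 / Real.sqrt t) with hq
  have hq0 : 0 ≤ q := by positivity
  have h4 : radius T (stateAt vmax ρ T v p t).observed * v t ≤ 2 / freqConst vmax ρ * q * vmax :=
    mul_le_mul h2 (hv t).2 (hv t).1 (by positivity)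
  have h5 := mul_nonneg h3 (hv t).1
  have h6 : 0 ≤ vmax / freqConst vmax ρ * q := by positivity
  have e1 : 2 / freqConst vmax ρ * q * vmax = 2 * (vmax / freqConst vmax ρ * q) := by ring
  have e2 : 6 * vmax / freqConst vmax ρ * q = 6 * (vmax / freqConst vmax ρ * q) := by ring
  have e3 : estimateConst vmax ρ * Real.sqrt (Real.log T) * (1 / Real.sqrt t) =
    12 * (vmax / freqConst vmax ρ * q) := by rw [estimateConst, hq]; ring
  rw [e1] at h4
  rw [e2] at h1
  rw [e3, abs_le]
  unfold estCost
  constructor <;> linarith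

end Estimates

/-! ### Favourable inputs are likely -/

section Main

variable {vmax ρ : ℝ} {T : ℕ} {F G : Measure ℝ}

/-- The deterministic bound on the pricing parameter. -/
noncomputable def lamBound (vmax ρ : ℝ) : ℝ := 3 / 2 * (vmax / ρ) + 1

/-- The event that the signed sum of centred rewards `f` over the entered rounds among the first
`n` ones is large; the reward of round `s` is evaluated at the value of round `j s`. -/
def bidDeviation (vmax ρ : ℝ) (T : ℕ) (G : Measure ℝ) (f : ℝ → ℝ → ℝ) (σ : ℝ) (j : ℕ → ℕ)
    (n : ℕ) : Set ((Fin T → ℝ) × (Fin T → ℝ)) :=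
  {z | 3 * vmax * Real.sqrt (n * Real.log T) < ∑ t ∈ Finset.Icc 1 n,
      σ * (act vmax ρ T (entry z.1) (entry z.2) t *
        (f (entry z.1 (j t)) (entry z.2 t) - bidMean f G (entry z.1 (j t))))}

lemma measureReal_union4_le {Ω : Type*} [MeasurableSpace Ω] {μ : Measure Ω} [IsFiniteMeasure μ]
    {A B C D : Set Ω} {x : ℝ} (hA : μ.real A ≤ x) (hB : μ.real B ≤ x) (hC : μ.real C ≤ x)
    (hD : μ.real D ≤ x) : μ.real (A ∪ B ∪ C ∪ D) ≤ 4 * x := by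
  have h1 := measureReal_union_le (μ := μ) (A ∪ B ∪ C) D
  have h2 := measureReal_union_le (μ := μ) (A ∪ B) C
  have h3 := measureReal_union_le (μ := μ) A B
  linarith

lemma abs_sum_le_of_not_mem {f : ℝ → ℝ → ℝ} {t : ℕ} {z : (Fin T → ℝ) × (Fin T → ℝ)}
    (h1 : z ∉ bidDeviation vmax ρ T G f 1 (fun _ => t) (t - 1))
    (h2 : z ∉ bidDeviation vmax ρ T G f (-1) (fun _ => t) (t - 1)) :
    |∑ s ∈ Finset.Icc 1 (t - 1), act vmax ρ T (entry z.1) (entry z.2) s *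
      (f (entry z.1 t) (entry z.2 s) - bidMean f G (entry z.1 t))| ≤
      3 * vmax * Real.sqrt ((t - 1 : ℕ) * Real.log T) := by
  simp only [bidDeviation, Set.mem_ofPred_eq, not_lt, ← Finset.mul_sum] at h1 h2
  rw [abs_le]
  constructor <;> linarith

lemma zero_mem_fluidValues (hρ : 0 ≤ ρ) : (0 : ℝ) ∈ fluidValues ρ F G :=
  ⟨fun _ => 0, measurable_const, fun _ => ⟨le_rfl, zero_le_one⟩, by simpa using hρ, by simp⟩

variable [IsProbabilityMeasure F] [IsProbabilityMeasure G]

/-- Outside an event of probability at most `4 / T`, the input is favourable. -/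
lemma exists_favourable (hρ : 0 < ρ) (hρv : ρ ≤ vmax) (hT : 2 ≤ T)
    (hF : F (Set.Icc 0 vmax) = 1) (hG : G (Set.Icc 0 vmax) = 1) {π : ℝ → ℝ} (hπm : Measurable π)
    (hπ : ∀ w, π w ∈ Set.Icc (0 : ℝ) 1) :
    ∃ bad : Set ((Fin T → ℝ) × (Fin T → ℝ)), (inputLaw T F G).real bad ≤ 4 / T ∧
      ∀ z ∈ boundedInputs T vmax, z ∉ bad →
        Favourable vmax ρ T (entry z.1) (entry z.2) (bidMean rev G) (bidMean cost G) π
          (∫ w, π w * bidMean rev G w ∂F) (∫ w, π w * bidMean cost G w ∂F)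
          (lamBound vmax ρ) (estimateConst vmax ρ) := by
  have hV : 0 < vmax := hρ.trans_le hρv
  have hLam : 0 < lamBound vmax ρ := by unfold lamBound; positivity
  have hT0 : (0 : ℝ) < T := by exact_mod_cast (by omega : 0 < T)
  have hT2 : (2 : ℝ) ≤ T := by exact_mod_cast hT
  set μ := inputLaw T F G
  have h1 : |(1 : ℝ)| = 1 := abs_one
  have h1' : |(-1 : ℝ)| = 1 := by simp
  have hrev := boundedReward_rev vmax
  have hcost := boundedReward_cost vmax
  -- the estimation errors
  set est : ℕ → Set ((Fin T → ℝ) × (Fin T → ℝ)) := fun t =>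
    bidDeviation vmax ρ T G rev 1 (fun _ => t) (t - 1) ∪
    bidDeviation vmax ρ T G rev (-1) (fun _ => t) (t - 1) ∪
    bidDeviation vmax ρ T G cost 1 (fun _ => t) (t - 1) ∪
    bidDeviation vmax ρ T G cost (-1) (fun _ => t) (t - 1) with hest
  have hest_le : ∀ t ∈ Finset.Icc 2 T, μ.real (est t) ≤ 4 * (1 / (T : ℝ) ^ 3) := by
    intro t ht
    have ht' := Finset.mem_Icc.1 ht
    exact measureReal_union4_le
      (bid_deviation hV hF hG hrev h1 _ (by omega) (by omega))
      (bid_deviation hV hF hG hrev h1' _ (by omega) (by omega))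
      (bid_deviation hV hF hG hcost h1 _ (by omega) (by omega))
      (bid_deviation hV hF hG hcost h1' _ (by omega) (by omega))
  -- the deviations of the policy
  have hpol : ∀ f : ℝ → ℝ → ℝ, BoundedReward vmax f → ∀ w ∈ Set.Icc 0 vmax,
      π w * bidMean f G w ∈ Set.Icc 0 vmax := fun f hf w hw => by
    have h2 := (hf.section_mem hG hw).2
    exact ⟨mul_nonneg (hπ w).1 h2.1, (mul_le_of_le_one_left h2.1 (hπ w).2).trans h2.2⟩
  have hagree : ∀ s t, s ≤ t → ∀ (z : (Fin T → ℝ) × (Fin T → ℝ)) (y : ℝ), ∀ i < s,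
      entry (setValue t z y).1 i = entry z.1 i := fun s t hst z y i hi =>
    entry_setEntry_of_ne (by omega) _ _
  have hdev1 := value_deviation (T := T) (F := F) (G := G) hV hF hG
    (hπm.mul hrev.measurable_bidMean) (hpol rev hrev)
    (W := fun t z => alive vmax ρ T (entry z.1) (entry z.2) t)
    (measurable_alive vmax ρ T measurable_value measurable_bid) one_pos
    (fun t z _ => by rw [abs_of_nonneg (alive_nonneg t)]; exact alive_le_one t)
    (fun s t hst z y => alive_congr (hagree s t hst z y) fun _ _ => rfl) (by omega)
  -- The weight is negated because `policy_cost` bounds realized minus mean, the opposite of the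
  -- order in `value_deviation`.
  have hdev2 := value_deviation (T := T) (F := F) (G := G) hV hF hG
    (hπm.mul hcost.measurable_bidMean) (hpol cost hcost)
    (W := fun t z => -(alive vmax ρ T (entry z.1) (entry z.2) t *
      (stateAt vmax ρ T (entry z.1) (entry z.2) t).lam))
    (fun t => ((measurable_alive vmax ρ T measurable_value measurable_bid t).mul
      (measurableState_stateAt vmax ρ T measurable_value measurable_bid t).lam).neg) hLam
    (fun t z hz => by
      rw [abs_neg, abs_of_nonneg (mul_nonneg (alive_nonneg t) (lam_nonneg t))]
      exact (mul_le_of_le_one_left (lam_nonneg t) (alive_le_one t)).trans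
        (lam_le (entry_mem_Icc hV.le hz.1) (entry_mem_Icc hV.le hz.2) hρ hρv t))
    (fun s t hst z y => by
      rw [alive_congr (hagree s t hst z y) fun _ _ => rfl,
        stateAt_congr (hagree s t hst z y) fun _ _ => rfl]
      rfl) (by omega)
  set dev1 := {z : (Fin T → ℝ) × (Fin T → ℝ) | 3 * (1 * vmax) * Real.sqrt (T * Real.log T) <
    ∑ t ∈ Finset.Icc 1 T, alive vmax ρ T (entry z.1) (entry z.2) t *
      (∫ w, (π * bidMean rev G) w ∂F - (π * bidMean rev G) (entry z.1 t))} with hd1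
  set dev2 := {z : (Fin T → ℝ) × (Fin T → ℝ) |
    3 * (lamBound vmax ρ * vmax) * Real.sqrt (T * Real.log T) <
    ∑ t ∈ Finset.Icc 1 T, -(alive vmax ρ T (entry z.1) (entry z.2) t *
      (stateAt vmax ρ T (entry z.1) (entry z.2) t).lam) *
      (∫ w, (π * bidMean cost G) w ∂F - (π * bidMean cost G) (entry z.1 t))} with hd2
  set fin := bidDeviation vmax ρ T G rev (-1) id T ∪ bidDeviation vmax ρ T G cost 1 id T ∪
    dev1 ∪ dev2 with hfin
  have hfin_le : μ.real fin ≤ 4 * (1 / (T : ℝ) ^ 3) :=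
    measureReal_union4_le (bid_deviation hV hF hG hrev h1' _ (by omega) le_rfl)
      (bid_deviation hV hF hG hcost h1 _ (by omega) le_rfl) hdev1 hdev2
  refine ⟨(⋃ t ∈ Finset.Icc 2 T, est t) ∪ fin, ?_, fun z hz hbad => ?_⟩
  · have h2 : μ.real (⋃ t ∈ Finset.Icc 2 T, est t) ≤ (T - 1) * (4 * (1 / (T : ℝ) ^ 3)) := by
      refine (measureReal_biUnion_finset_le _ _).trans ((Finset.sum_le_sum hest_le).trans_eq ?_)
      rw [Finset.sum_const, Nat.card_Icc, nsmul_eq_mul, show T + 1 - 2 = T - 1 by omega,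
        Nat.cast_sub (by omega), Nat.cast_one]
    -- Four events for each of the `T - 1` rounds and four final ones, each of probability at most
    -- `T⁻³`, total `4 / T²`.
    have h3 : (T - 1) * (4 * (1 / (T : ℝ) ^ 3)) + 4 * (1 / (T : ℝ) ^ 3) ≤ 4 / T := by
      have : (T - 1) * (4 * (1 / (T : ℝ) ^ 3)) + 4 * (1 / (T : ℝ) ^ 3) = 4 / T * (1 / T) := by
        field_simp; ring
      rw [this]
      exact mul_le_of_le_one_right (by positivity)
        ((div_le_one hT0).2 (by linarith))
    exact (measureReal_union_le _ _).trans ((add_le_add h2 hfin_le).trans h3)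
  · have hv := entry_mem_Icc hV.le hz.1
    simp only [Set.mem_union, Set.mem_iUnion, not_or, not_exists, hest, hfin] at hbad
    obtain ⟨hbe, ⟨⟨hb1, hb2⟩, hb3⟩, hb4⟩ := hbad
    refine ⟨fun t ht hr => ?_, fun t ht hr => ?_, ?_, ?_, ?_, ?_⟩
    · obtain ⟨⟨⟨e1, e2⟩, e3⟩, e4⟩ := hbe t ht
      exact estRev_close hρ hρv hv hT (Finset.mem_Icc.1 ht).1 hr (abs_sum_le_of_not_mem e1 e2)
    · obtain ⟨⟨⟨e1, e2⟩, e3⟩, e4⟩ := hbe t ht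
      exact estCost_close hρ hρv hv hT (Finset.mem_Icc.1 ht).1 hr (abs_sum_le_of_not_mem e3 e4)
    · refine le_of_eq_of_le (Finset.sum_congr rfl fun t _ => ?_) (not_lt.1 hb1)
      simp only [id]; ring
    · refine le_of_eq_of_le (Finset.sum_congr rfl fun t _ => ?_) (not_lt.1 hb2)
      simp only [id]; ring
    · refine (le_of_eq_of_le (Finset.sum_congr rfl fun t _ => ?_) (not_lt.1 hb3)).trans_eq (by ring)
      simp only [Pi.mul_apply]
    · refine (le_of_eq_of_le (Finset.sum_congr rfl fun t _ => ?_) (not_lt.1 hb4)).trans_eq (by ring)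
      simp only [Pi.mul_apply]; ring

/-! ### The fluid benchmark -/

/-- By Fubini, a policy that sees only the value interacts with the bid only through its mean
reward. -/
lemma integral_policy_eq (hF : F (Set.Icc 0 vmax) = 1) (hG : G (Set.Icc 0 vmax) = 1)
    {f : ℝ → ℝ → ℝ} (hf : BoundedReward vmax f) {π : ℝ → ℝ} (hπm : Measurable π)
    (hπ : ∀ w, π w ∈ Set.Icc (0 : ℝ) 1) :
    ∫ z, π z.1 * f z.1 z.2 ∂(F.prod G) = ∫ w, π w * bidMean f G w ∂F := by
  have hint : Integrable (fun z : ℝ × ℝ => π z.1 * f z.1 z.2) (F.prod G) := by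
    refine Integrable.of_mem_Icc 0 vmax ((hπm.comp measurable_fst).mul hf.measurable).aemeasurable ?_
    have h1 := (Measure.quasiMeasurePreserving_fst (μ := F) (ν := G)).ae (ae_mem_Icc hF)
    have h2 := (Measure.quasiMeasurePreserving_snd (μ := F) (ν := G)).ae (ae_mem_Icc hG)
    filter_upwards [h1, h2] with z hz1 hz2
    have h3 := hf.mem _ hz1 _ hz2
    exact ⟨mul_nonneg (hπ _).1 h3.1, (mul_le_of_le_one_left h3.1 (hπ _).2).trans h3.2⟩
  rw [integral_prod _ hint]
  simp only [integral_const_mul]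
  rfl

lemma policy_mean_mem (hF : F (Set.Icc 0 vmax) = 1) (hG : G (Set.Icc 0 vmax) = 1)
    {f : ℝ → ℝ → ℝ} (hf : BoundedReward vmax f) {π : ℝ → ℝ} (hπm : Measurable π)
    (hπ : ∀ w, π w ∈ Set.Icc (0 : ℝ) 1) :
    ∫ w, π w * bidMean f G w ∂F ∈ Set.Icc 0 vmax := by
  refine (integral_mem_Icc (hπm.mul hf.measurable_bidMean) ?_).2
  filter_upwards [ae_mem_Icc hF] with w hw
  have h2 := (hf.section_mem hG hw).2
  exact ⟨mul_nonneg (hπ w).1 h2.1, (mul_le_of_le_one_left h2.1 (hπ w).2).trans h2.2⟩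

lemma fluidValues_le (hF : F (Set.Icc 0 vmax) = 1) (hG : G (Set.Icc 0 vmax) = 1) {R : ℝ}
    (hR : R ∈ fluidValues ρ F G) : R ≤ vmax := by
  obtain ⟨π, hπm, hπ, -, rfl⟩ := hR
  rw [integral_policy_eq hF hG (boundedReward_rev vmax) hπm hπ]
  exact (policy_mean_mem hF hG (boundedReward_rev vmax) hπm hπ).2

lemma OPT_le (hρ : 0 ≤ ρ) (hF : F (Set.Icc 0 vmax) = 1) (hG : G (Set.Icc 0 vmax) = 1) :
    OPT ρ T F G ≤ T * vmax :=
  mul_le_mul_of_nonneg_left (csSup_le ⟨0, zero_mem_fluidValues hρ⟩ fun _ hR =>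
    fluidValues_le hF hG hR) (Nat.cast_nonneg _)

/-! ### The regret bounds -/

/-- The constant of the high-probability regret bound. -/
noncomputable def highProbConst (vmax ρ : ℝ) : ℝ :=
  regretConst vmax (lamBound vmax ρ) (estimateConst vmax ρ) + vmax

lemma highProbConst_nonneg (hρ : 0 < ρ) (hV : 0 < vmax) : 0 ≤ highProbConst vmax ρ := by
  have hC := freqConst_pos hρ hV
  unfold highProbConst regretConst lamBound estimateConst
  positivity

lemma measurable_regret (vmax ρ : ℝ) (T : ℕ) (F G : Measure ℝ) :
    Measurable fun z : (Fin T → ℝ) × (Fin T → ℝ) => regret vmax ρ F G z :=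
  (measurable_revenue vmax ρ T).const_sub _

lemma measureReal_regret_gt_le (hρ : 0 < ρ) (hρv : ρ ≤ vmax) (hT : 2 ≤ T)
    (hF : F (Set.Icc 0 vmax) = 1) (hG : G (Set.Icc 0 vmax) = 1) :
    (inputLaw T F G).real {z | regret vmax ρ F G z ≤
      highProbConst vmax ρ * Real.sqrt (T * Real.log T)}ᶜ ≤ 4 / T := by
  have hV : 0 < vmax := hρ.trans_le hρv
  have hT0 : (0 : ℝ) < T := by exact_mod_cast (by omega : 0 < T)
  -- The supremum is not shown to be attained. A policy within `vmax / T` of it loses only `vmax`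
  -- over all rounds, the extra summand of `highProbConst`.
  obtain ⟨R, hR, hsup⟩ := exists_lt_of_lt_csSup ⟨0, zero_mem_fluidValues (F := F) (G := G) hρ.le⟩
    (sub_lt_self (sSup (fluidValues ρ F G)) (div_pos hV hT0))
  obtain ⟨π, hπm, hπ, hK, rfl⟩ := hR
  rw [integral_policy_eq hF hG (boundedReward_cost vmax) hπm hπ] at hK
  rw [integral_policy_eq hF hG (boundedReward_rev vmax) hπm hπ] at hsup
  obtain ⟨bad, hbad, hfav⟩ := exists_favourable hρ hρv hT hF hG hπm hπ
  refine le_trans (ENNReal.toReal_mono (measure_ne_top _ _) (measure_mono_ae ?_)) hbad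
  filter_upwards [ae_mem_boundedInputs (T := T) hF hG] with z hz hzS
  by_contra hzb
  refine hzS ?_
  have hv := entry_mem_Icc hV.le hz.1
  have hp := entry_mem_Icc hV.le hz.2
  have hLam : vmax / ρ ≤ lamBound vmax ρ := by
    have : 0 < vmax / ρ := by positivity
    unfold lamBound
    linarith
  have hC := freqConst_pos hρ hV
  have hmain := (hfav z hz hzb).regret_le (Lam := lamBound vmax ρ) hρ hρv hT hv hp
    (fun t => ((boundedReward_rev vmax).section_mem hG (hv t)).2)
    (fun t => ((boundedReward_cost vmax).section_mem hG (hv t)).2) hπ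
    (policy_mean_mem hF hG (boundedReward_rev vmax) hπm hπ) hK
    (by unfold estimateConst; positivity) (lam_le hv hp hρ hρv) hLam
  rw [← revenue_eq] at hmain
  have hQ := le_mul_of_one_le_right hV.le (sqrt_log_facts hT).1
  have hOPT : OPT ρ T F G ≤ T * (∫ w, π w * bidMean rev G w ∂F) + vmax := by
    have h1 := mul_le_mul_of_nonneg_left hsup.le hT0.le
    rw [mul_sub, mul_div_cancel₀ _ hT0.ne'] at h1
    unfold OPT
    linarith
  change regret vmax ρ F G z ≤ _
  unfold regret highProbConst
  linarith

lemma highProb_bound (hρ : 0 < ρ) (hρv : ρ ≤ vmax) (hT : 1 ≤ T)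
    (hF : F (Set.Icc 0 vmax) = 1) (hG : G (Set.Icc 0 vmax) = 1) :
    1 - 4 / (T : ℝ) ≤ (inputLaw T F G).real {z | regret vmax ρ F G z ≤
      highProbConst vmax ρ * Real.sqrt (T * Real.log T)} := by
  rcases hT.eq_or_lt with rfl | hT2
  -- For `T = 1` the claimed probability `1 - 4` is negative.
  · exact le_trans (by norm_num) measureReal_nonneg
  · have h := measureReal_regret_gt_le hρ hρv hT2 hF hG
    rw [probReal_compl_eq_one_sub
      (measurableSet_le (measurable_regret vmax ρ T F G) measurable_const)] at h
    linarith

lemma revenue_mem (hV : 0 < vmax) {z : (Fin T → ℝ) × (Fin T → ℝ)}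
    (hz : z ∈ boundedInputs T vmax) : revenue vmax ρ z.1 z.2 ∈ Set.Icc 0 (T * vmax) := by
  have hv := entry_mem_Icc hV.le hz.1
  have hp := entry_mem_Icc hV.le hz.2
  rw [revenue_eq]
  refine ⟨Finset.sum_nonneg fun t _ => mul_nonneg (act_nonneg t) (rev_nonneg _ _), ?_⟩
  calc _ ≤ ∑ _t ∈ Finset.Icc 1 T, vmax := Finset.sum_le_sum fun t _ =>
        (mul_le_of_le_one_left (rev_nonneg _ _) (act_le_one t)).trans
          ((rev_le (hv t).1 (hp t).1).trans (hv t).2)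
    _ = T * vmax := by simp

/-- On the exceptional event the regret is still at most `T vmax`; with probability at most `4 / T`
this contributes only `4 vmax`. -/
lemma expected_bound (hρ : 0 < ρ) (hρv : ρ ≤ vmax) (hT : 2 ≤ T)
    (hF : F (Set.Icc 0 vmax) = 1) (hG : G (Set.Icc 0 vmax) = 1) :
    Integrable (regret vmax ρ F G) (inputLaw T F G) ∧
      ∫ z, regret vmax ρ F G z ∂(inputLaw T F G) ≤
        (highProbConst vmax ρ + 4 * vmax) * Real.sqrt (T * Real.log T) := by
  have hV : 0 < vmax := hρ.trans_le hρv
  have hT0 : (0 : ℝ) < T := by exact_mod_cast (by omega : 0 < T)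
  have hC := highProbConst_nonneg hρ hV
  have hgood := ae_mem_boundedInputs (T := T) hF hG
  have hint : Integrable (regret vmax ρ F G) (inputLaw T F G) := by
    refine (integrable_const (OPT ρ T F G)).sub ?_
    exact Integrable.of_mem_Icc 0 (T * vmax) (measurable_revenue vmax ρ T).aemeasurable
      (hgood.mono fun z hz => revenue_mem hV hz)
  refine ⟨hint, ?_⟩
  set Q := Real.sqrt (T * Real.log T)
  set S := {z : (Fin T → ℝ) × (Fin T → ℝ) | regret vmax ρ F G z ≤ highProbConst vmax ρ * Q}
  have hS : MeasurableSet S := measurableSet_le (measurable_regret vmax ρ T F G) measurable_const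
  have hbad := measureReal_regret_gt_le hρ hρv hT hF hG
  have hbint : Integrable (fun z => highProbConst vmax ρ * Q +
      Sᶜ.indicator (fun _ => T * vmax) z) (inputLaw T F G) :=
    (integrable_const _).add ((integrable_const _).indicator hS.compl)
  calc ∫ z, regret vmax ρ F G z ∂(inputLaw T F G)
      ≤ ∫ z, (highProbConst vmax ρ * Q + Sᶜ.indicator (fun _ => T * vmax) z)
          ∂(inputLaw T F G) := by
        refine integral_mono_ae hint hbint ?_
        filter_upwards [hgood] with z hz
        by_cases hzS : z ∈ S
        · rw [Set.indicator_of_notMem (by simpa using hzS), add_zero]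
          exact hzS
        · rw [Set.indicator_of_mem (by simpa using hzS)]
          have h1 := OPT_le (T := T) hρ.le hF hG
          have h2 := (revenue_mem (ρ := ρ) hV hz).1
          have h3 : 0 ≤ highProbConst vmax ρ * Q := mul_nonneg hC (Real.sqrt_nonneg _)
          unfold regret
          linarith
    _ = highProbConst vmax ρ * Q + (inputLaw T F G).real Sᶜ * (T * vmax) := by
        rw [integral_add (integrable_const _) ((integrable_const _).indicator hS.compl),
          integral_indicator_const _ hS.compl]
        simp
    _ ≤ highProbConst vmax ρ * Q + 4 / T * (T * vmax) := by gcongr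
    _ = highProbConst vmax ρ * Q + 4 * vmax := by field_simp
    _ ≤ (highProbConst vmax ρ + 4 * vmax) * Q := by
        have := le_mul_of_one_le_right hV.le (sqrt_log_facts hT).1
        linarith

end Main

end OGDCB

theorem mainTheorem6 (vmax ρ : ℝ) (hρ : 0 < ρ) (hρv : ρ ≤ vmax) :
    -- entering frequency: holds on every input, for every `t ≥ 2` whose previous round was executed
    (∀ (T : ℕ) (v p : Fin T → ℝ),
      (∀ i, v i ∈ Set.Icc 0 vmax) → (∀ i, p i ∈ Set.Icc 0 vmax) →
      ∀ t : ℕ, 2 ≤ t → t ≤ T + 1 →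
        (OGDCB.stateAt vmax ρ T (OGDCB.entry v) (OGDCB.entry p) (t - 1)).running →
        OGDCB.freqConst vmax ρ * ((t : ℝ) - 1) ≤
          ((OGDCB.stateAt vmax ρ T (OGDCB.entry v) (OGDCB.entry p) t).observed.card : ℝ)) ∧
    -- regret with high probability
    (∃ C : ℝ, ∀ (T : ℕ), 1 ≤ T →
      ∀ (F G : Measure ℝ) [IsProbabilityMeasure F] [IsProbabilityMeasure G],
        F (Set.Icc 0 vmax) = 1 → G (Set.Icc 0 vmax) = 1 →
        1 - 4 / (T : ℝ) ≤
          (OGDCB.inputLaw T F G).real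
            {z | OGDCB.regret vmax ρ F G z ≤ C * Real.sqrt (T * Real.log T)}) ∧
    -- expected regret
    (∃ C : ℝ, ∀ (T : ℕ), 2 ≤ T →
      ∀ (F G : Measure ℝ) [IsProbabilityMeasure F] [IsProbabilityMeasure G],
        F (Set.Icc 0 vmax) = 1 → G (Set.Icc 0 vmax) = 1 →
        Integrable (OGDCB.regret vmax ρ F G) (OGDCB.inputLaw T F G) ∧
        ∫ z, OGDCB.regret vmax ρ F G z ∂(OGDCB.inputLaw T F G) ≤
          C * Real.sqrt (T * Real.log T)) := by
  have hV : 0 < vmax := hρ.trans_le hρv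
  refine ⟨fun T v p hv _ t ht _ hrun => ?_, ⟨OGDCB.highProbConst vmax ρ, fun T hT F G _ _ hF hG =>
    OGDCB.highProb_bound hρ hρv hT hF hG⟩, ⟨OGDCB.highProbConst vmax ρ + 4 * vmax,
    fun T hT F G _ _ hF hG => OGDCB.expected_bound hρ hρv hT hF hG⟩⟩
  exact OGDCB.freqConst_mul_le_card_observed (OGDCB.entry_mem_Icc hV.le hv) hρ hρv t ht hrun
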